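/- **Setting.** Fix $R,T_0,\delta>0$ and parameters $-\tfrac12\le\nu<1$, $0\le\theta<1$, $0\le\Gamma<1$. Microscopic states are $(v,I,i)\in\mathbb R^3\times(0,\infty)\times\mathbb N$, where $\varepsilon=I^{2/\delta}$ is the rotational energy and $iRT_0$ the vibrational energy; write $\langle\phi\rangle=\sum_{i\ge0}\int_{\mathbb R^3}\int_0^\infty\phi(v,I,i)\,dI\,dv$. For $T>0$ let $e_{tr}(T)=\tfrac32RT$, $e_{rot}(T)=\tfrac\delta2RT$, $e_{vib}(T)=RT_0/(e^{T_0/T}-1)$, $e_{tr,rot}=e_{tr}+e_{rot}$, $e=e_{tr}+e_{rot}+e_{vib}$; their inverse functions are denoted $e_\bullet^{-1}$. A *distribution* is a measurable $g\ge0$ whose integrals against $1,\ |v|^2,\ I^{2/\delta},\ i$ are finite and with $\rho:=\langle g\rangle>0$. Put $\rho u=\langle vg\rangle$, $\rho\Theta=\langle(v-u)\otimes(v-u)g\rangle$, $\rho E_{tr}=\langle\frac12|v-u|^2g\rangle$, $\rho E_{rot}=\langle I^{2/\delta}g\rangle$, $\rho E_{vib}=\langle iRT_0g\rangle$, $E=E_{tr}+E_{rot}+E_{vib}$,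 $T_{tr}=e_{tr}^{-1}(E_{tr})$ (so that $\mathrm{Tr}\,\Theta=3RT_{tr}$), $T_{tr,rot}=e_{tr,rot}^{-1}(E_{tr}+E_{rot})$, $T_{eq}=e^{-1}(E)$, and $$\Pi=\Gamma RT_{eq}\mathrm I+(1-\Gamma)\big[\theta RT_{tr,rot}\mathrm I+(1-\theta)(\nu\Theta+(1-\nu)RT_{tr}\mathrm I)\big],$$ $$e_{rot}^{rel}=\Gamma e_{rot}(T_{eq})+(1-\Gamma)[\theta e_{rot}(T_{tr,rot})+(1-\theta)E_{rot}],\qquad e_{vib}^{rel}=\Gamma e_{vib}(T_{eq})+(1-\Gamma)E_{vib},$$ $T_{rot}^{rel}=e_{rot}^{-1}(e_{rot}^{rel})$, $T_{vib}^{rel}=e_{vib}^{-1}(e_{vib}^{rel})$. With $\Lambda(\delta)=1/\boldsymbol\Gamma(\delta/2)$, where $\boldsymbol\Gamma$ is the gamma function, let $$\mathcal G[g]=\rho\,\frac2\delta\,\frac{\Lambda(\delta)(1-e^{-T_0/T_{vib}^{rel}})}{\sqrt{\det(2\pi\Pi)}\,(RT_{rot}^{rel})^{\delta/2}}\exp\Big(-\tfrac12(v-u)^T\Pi^{-1}(v-u)-\frac{I^{2/\delta}}{RT_{rot}^{rel}}-i\frac{T_0}{T_{vib}^{rel}}\Big),$$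 $$\mathcal M[g]=\rho\,\frac2\delta\,\frac{\Lambda(\delta)(1-e^{-T_0/T_{eq}})}{(2\pi RT_{eq})^{3/2}(RT_{eq})^{\delta/2}}\exp\Big(-\frac{|v-u|^2}{2RT_{eq}}-\frac{I^{2/\delta}}{RT_{eq}}-i\frac{T_0}{T_{eq}}\Big).$$ The entropy is $\mathbb H(\phi)=\langle\phi\log\phi-\phi\rangle$ (with $0\log0=0$). Equality of distributions means equality almost everywhere. The Gaussian $\mathcal G[g]$ is considered when $e_{vib}^{rel}>0$, i.e. unless $\Gamma=0$ and $g$ is concentrated on $i=0$. **Proposition.** 1. If $\Theta$ is a symmetric positive definite $3\times3$ matrix, $T_{tr},T_{tr,rot},T_{eq}>0$ and $\mathrm{Tr}\,\Theta=3RT_{tr}$, then $\Pi$ given by the formula above is symmetric positive definite. 2. (Entropy minimization) Let $g$ be a distribution with $e_{vib}^{rel}>0$, and let $\mathcal X$ be the set of measurable $\phi\ge0$ with finite moments $\langle\phi\rangle=\rho$, $\langle v\phi\rangle=\rho u$, $\langle v\otimes v\,\phi\rangle=\rho(u\otimes u+\Pi)$, $\langle I^{2/\delta}\phi\rangle=\rho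 e_{rot}^{rel}$, $\langle iRT_0\phi\rangle=\rho e_{vib}^{rel}$. Then $\mathcal G[g]\in\mathcal X$, $\mathbb H(\mathcal G[g])$ is finite, and $\mathcal G[g]$ is the unique minimizer on $\mathcal X$ of $\mathbb H$, which takes values in $(-\infty,+\infty]$ there. 3. (H-theorem) Let $U\subset\mathbb R\times\mathbb R^3$ be open, $\tau:U\to(0,\infty)$, and let $g(t,x,v,I,i)\ge0$, $(t,x)\in U$, be a classical solution of $\partial_tg+v\cdot\nabla_xg=\frac1\tau(\mathcal G[g]-g)$: for each $(t,x)\in U$, $g(t,x,\cdot)$ is a distribution with $e_{vib}^{rel}>0$, and for a.e. $(v,I,i)$ the function $g$ is non-negative and differentiable in $(t,x)$ and satisfies the equation at every point of $U$. Assume that $(1+|v|)(g\log g-g)$ is integrable in $(v,I,i)$ for each $(t,x)\in U$, and that $(1+|v|)\,|\log g|\,|D_{t,x}g|$ is dominated, locally uniformly in $(t,x)\in U$, by an integrable function of $(v,I,i)$. Then on $U$ the functions $\mathbb H(g)$ and $\langle v(g\log g-g)\rangle$ are differentiable, $\frac1\tau(\mathcal G[g]-g)\log g$ is integrable in $(v,I,i)$,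 and $$\partial_t\mathbb H(g)+\nabla_x\cdot\langle v(g\log g-g)\rangle=\Big\langle\frac1\tau(\mathcal G[g]-g)\log g\Big\rangle\le0.$$ 4. (Equilibrium) If $\Gamma>0$ and $g$ is a distribution with $g=\mathcal G[g]$, then $g=\mathcal M[g]$. -/

import Mathlib

open MeasureTheory

noncomputable section

namespace ESBGK

/-- Velocity space, and also position space. -/
abbrev V : Type := EuclideanSpace ℝ (Fin 3)

/-- Microscopic states `(v, I, i)`: velocity, rotational variable `I` (the rotational energy is
`I ^ (2 / δ)`) and vibrational level. The variable `I` ranges over `(0, ∞)`; this is built into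
`stateMeasure`. -/
abbrev State : Type := V × ℝ × ℕ

/-- The measure `dv dI di` on `ℝ³ × (0, ∞) × ℕ`; the bracket `⟨φ⟩` is the integral against it. -/
def stateMeasure : Measure State :=
  (volume : Measure V).prod
    (((volume : Measure ℝ).restrict (Set.Ioi 0)).prod (Measure.count : Measure ℕ))

/-- Physical constants of the gas (gas constant `R`, characteristic vibrational temperature `T₀`,
number `δ` of rotational degrees of freedom) and the parameters `ν, θ, Γ` of the model. -/
structure Params where
  R : ℝ
  T₀ : ℝ
  δ : ℝ
  ν : ℝ
  θ : ℝ
  Γ : ℝ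

variable (P : Params)

/-! Energies of the modes at equilibrium, and their inverses. -/

/-- `e_tr(T)` -/
def eTr (T : ℝ) : ℝ := 3 / 2 * P.R * T

/-- `e_rot(T)` -/
def eRot (T : ℝ) : ℝ := P.δ / 2 * P.R * T

/-- `e_vib(T)` -/
def eVib (T : ℝ) : ℝ := P.R * P.T₀ / (Real.exp (P.T₀ / T) - 1)

/-- `e(T)` -/
def eTot (T : ℝ) : ℝ := eTr P T + eRot P T + eVib P T

/-- Inverse of `e_tr`. -/
def eTrInv (E : ℝ) : ℝ := 2 / (3 * P.R) * E

/-- Inverse of `e_rot`. -/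
def eRotInv (E : ℝ) : ℝ := 2 / (P.δ * P.R) * E

/-- Inverse of `e_tr + e_rot`. -/
def eTrRotInv (E : ℝ) : ℝ := 2 / ((3 + P.δ) * P.R) * E

/-- Inverse of `e_vib`. -/
def eVibInv (E : ℝ) : ℝ := P.T₀ / Real.log (1 + P.R * P.T₀ / E)

/-- Inverse of `e` on `(0, ∞)`: the positive temperature `T` with `e(T) = E`. -/
def eTotInv (E : ℝ) : ℝ := Function.invFunOn (eTot P) (Set.Ioi 0) E

/-! Moments of a distribution `g(v, I, i)` (per unit mass) and the associated temperatures. -/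

variable (g : State → ℝ)

/-- Mass density `ρ`. -/
def rho : ℝ := ∫ z, g z ∂stateMeasure

/-- Mean velocity `u`. -/
def u (j : Fin 3) : ℝ := (rho g)⁻¹ * ∫ z, z.1 j * g z ∂stateMeasure

/-- The tensor `Θ`, with `ρ Θ = ⟨(v - u) ⊗ (v - u) g⟩`. -/
def stress : Matrix (Fin 3) (Fin 3) ℝ := fun j k =>
  (rho g)⁻¹ * ∫ z, (z.1 j - u g j) * (z.1 k - u g k) * g z ∂stateMeasure

/-- `E_tr(g)` -/
def ETr : ℝ := (rho g)⁻¹ * ∫ z, 1 / 2 * (∑ j, (z.1 j - u g j) ^ 2) * g z ∂stateMeasure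

/-- `E_rot(g)` -/
def ERot : ℝ := (rho g)⁻¹ * ∫ z, z.2.1 ^ (2 / P.δ) * g z ∂stateMeasure

/-- `E_vib(g)` -/
def EVib : ℝ := (rho g)⁻¹ * ∫ z, (z.2.2 : ℝ) * P.R * P.T₀ * g z ∂stateMeasure

/-- The total internal energy `E(g)`. -/
def ETot : ℝ := ETr g + ERot P g + EVib P g

/-- `T_tr` -/
def TTr : ℝ := eTrInv P (ETr g)

/-- `T_{tr,rot}` -/
def TTrRot : ℝ := eTrRotInv P (ETr g + ERot P g)

/-- `T_eq` -/
def TEq : ℝ := eTotInv P (ETot P g)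

/-! The relaxation quantities. -/

/-- The tensor `Π` as a function of `Θ`, `T_tr`, `T_{tr,rot}` and `T_eq`. -/
def correctedTensor (Θ : Matrix (Fin 3) (Fin 3) ℝ) (Ttr Ttrrot Teq : ℝ) :
    Matrix (Fin 3) (Fin 3) ℝ :=
  (P.Γ * P.R * Teq) • (1 : Matrix (Fin 3) (Fin 3) ℝ) +
    (1 - P.Γ) • ((P.θ * P.R * Ttrrot) • (1 : Matrix (Fin 3) (Fin 3) ℝ) +
      (1 - P.θ) • (P.ν • Θ + ((1 - P.ν) * P.R * Ttr) • (1 : Matrix (Fin 3) (Fin 3) ℝ)))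

/-- The corrected tensor `Π` of `g`. -/
def piTensor : Matrix (Fin 3) (Fin 3) ℝ :=
  correctedTensor P (stress g) (TTr P g) (TTrRot P g) (TEq P g)

/-- `e_rot^rel` -/
def eRotRel : ℝ :=
  P.Γ * eRot P (TEq P g) +
    (1 - P.Γ) * (P.θ * eRot P (TTrRot P g) + (1 - P.θ) * ERot P g)

/-- `e_vib^rel` -/
def eVibRel : ℝ := P.Γ * eVib P (TEq P g) + (1 - P.Γ) * EVib P g

/-- `T_rot^rel` -/
def TRotRel : ℝ := eRotInv P (eRotRel P g)

/-- `T_vib^rel` -/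
def TVibRel : ℝ := eVibInv P (eVibRel P g)

/-! The Gaussian and the Maxwellian. -/

/-- The normalization constant `Λ(δ)`. -/
def Lam : ℝ := 1 / Real.Gamma (P.δ / 2)

/-- The Gaussian `𝓖[g]`, in the variables `(v, I, i)`. -/
def gaussian (z : State) : ℝ :=
  rho g * (2 / P.δ) *
    (Lam P * (1 - Real.exp (-(P.T₀ / TVibRel P g))) /
      (Real.sqrt ((2 * Real.pi) • piTensor P g).det * (P.R * TRotRel P g) ^ (P.δ / 2))) *
    Real.exp
      (-(1 / 2) * ((fun j => z.1 j - u g j) ⬝ᵥ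
          Matrix.mulVec (piTensor P g)⁻¹ (fun j => z.1 j - u g j))
        - z.2.1 ^ (2 / P.δ) / (P.R * TRotRel P g)
        - (z.2.2 : ℝ) * (P.T₀ / TVibRel P g))

/-- The Maxwellian `𝓜[g]`, in the variables `(v, I, i)`. -/
def maxwellian (z : State) : ℝ :=
  rho g * (2 / P.δ) *
    (Lam P * (1 - Real.exp (-(P.T₀ / TEq P g))) /
      ((2 * Real.pi * P.R * TEq P g) ^ (3 / 2 : ℝ) * (P.R * TEq P g) ^ (P.δ / 2))) *
    Real.exp
      (-(∑ j, (z.1 j - u g j) ^ 2) / (2 * P.R * TEq P g)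
        - z.2.1 ^ (2 / P.δ) / (P.R * TEq P g)
        - (z.2.2 : ℝ) * (P.T₀ / TEq P g))

/-! Distributions, and the set on which the entropy is minimized. -/

/-- Non-negative measurable functions of `(v, I, i)` all of whose moments against
`1, v, v ⊗ v, I ^ (2 / δ), i R T₀` are finite. -/
structure FiniteMoments : Prop where
  meas : AEStronglyMeasurable g stateMeasure
  nonneg : ∀ᵐ z ∂stateMeasure, 0 ≤ g z
  integrable : Integrable
    (fun z : State => (1 + ‖z.1‖ ^ 2 + z.2.1 ^ (2 / P.δ) + (z.2.2 : ℝ)) * g z) stateMeasure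

/-- A non-negative distribution: finite moments and positive mass density. -/
structure IsDistribution : Prop where
  finiteMoments : FiniteMoments P g
  rho_pos : 0 < rho g

/-- The set `𝒳` of the `φ ≥ 0` with
`⟨m φ⟩ = (ρ, ρ u, ρ (u ⊗ u + Π), ρ e_rot^rel, ρ e_vib^rel)`. -/
def momentSet : Set (State → ℝ) :=
  {φ | FiniteMoments P φ ∧
    ∫ z, φ z ∂stateMeasure = rho g ∧
    (∀ j, ∫ z, z.1 j * φ z ∂stateMeasure = rho g * u g j) ∧
    (∀ j k, ∫ z, z.1 j * z.1 k * φ z ∂stateMeasure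
      = rho g * (u g j * u g k + piTensor P g j k)) ∧
    ∫ z, z.2.1 ^ (2 / P.δ) * φ z ∂stateMeasure = rho g * eRotRel P g ∧
    ∫ z, (z.2.2 : ℝ) * P.R * P.T₀ * φ z ∂stateMeasure = rho g * eVibRel P g}

/-! Entropy. -/

/-- `s log s - s` (with the value `0` at `s = 0`). -/
def entropyDensity (s : ℝ) : ℝ := s * Real.log s - s

/-- The entropy `ℍ(g) = ⟨g log g - g⟩` of a distribution of finite entropy. -/
def entropy : ℝ := ∫ z, entropyDensity (g z) ∂stateMeasure

/-- The entropy `ℍ(g) = ⟨g log g - g⟩` as an extended real number: integral of the positive part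
minus integral of the negative part. -/
def extEntropy : EReal :=
  ((∫⁻ z, ENNReal.ofReal (entropyDensity (g z)) ∂stateMeasure : ENNReal) : EReal) -
    ((∫⁻ z, ENNReal.ofReal (-entropyDensity (g z)) ∂stateMeasure : ENNReal) : EReal)

/-- For a distribution of finite entropy the two definitions agree. -/
theorem extEntropy_eq_entropy
    (h : Integrable (fun z => entropyDensity (g z)) stateMeasure) :
    extEntropy g = (entropy g : EReal) := by
  have h1 : (∫⁻ z, ENNReal.ofReal (entropyDensity (g z)) ∂stateMeasure) ≠ ⊤ :=
    h.lintegral_lt_top.ne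
  have h2 : (∫⁻ z, ENNReal.ofReal (-entropyDensity (g z)) ∂stateMeasure) ≠ ⊤ :=
    h.neg.lintegral_lt_top.ne
  unfold extEntropy entropy
  rw [integral_eq_lintegral_pos_part_sub_lintegral_neg_part h, EReal.coe_sub,
    EReal.coe_ennreal_toReal h1, EReal.coe_ennreal_toReal h2]

/-- The entropy flux `⟨v (g log g - g)⟩`. -/
def entropyFlux (j : Fin 3) : ℝ := ∫ z, z.1 j * entropyDensity (g z) ∂stateMeasure

/-! The kinetic equation. -/

/-- `∂_t F` -/
def dt (F : ℝ × V → ℝ) (y : ℝ × V) : ℝ := fderiv ℝ F y (1, 0)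

/-- `∂_{x_j} F` -/
def dx (j : Fin 3) (F : ℝ × V → ℝ) (y : ℝ × V) : ℝ :=
  fderiv ℝ F y (0, EuclideanSpace.single j 1)

/-- Classical solutions of the model `∂_t f + v · ∇ f = (𝓖[f] - f) / τ`, on an open set `U` of
pairs `(t, x)`. The last two fields are the regularity and decay which give a meaning to the
entropy, to its flux, and to their first derivatives: the entropy densities are integrable,
and the first derivatives in `(t, x)` of `f log f - f` and of `v (f log f - f)`, which are bounded
by `(1 + |v|) |log f| |D f|`, are dominated, locally uniformly in `(t, x)`, by an integrable
function of `(v, I, i)`. -/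
structure IsClassicalSolution (τ : ℝ × V → ℝ) (U : Set (ℝ × V)) (f : ℝ × V → State → ℝ) :
    Prop where
  isDistribution : ∀ y ∈ U, IsDistribution P (f y)
  eVibRel_pos : ∀ y ∈ U, 0 < eVibRel P (f y)
  nonneg : ∀ᵐ z ∂stateMeasure, ∀ y ∈ U, 0 ≤ f y z
  differentiable : ∀ᵐ z ∂stateMeasure, ∀ y ∈ U, DifferentiableAt ℝ (fun y' => f y' z) y
  equation : ∀ᵐ z ∂stateMeasure, ∀ y ∈ U,
    dt (fun y' => f y' z) y + ∑ j, z.1 j * dx j (fun y' => f y' z) y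
      = 1 / τ y * (gaussian P (f y) z - f y z)
  integrable_entropy : ∀ y ∈ U,
    Integrable (fun z : State => (1 + ‖z.1‖) * |entropyDensity (f y z)|) stateMeasure
  dominated : ∀ y₀ ∈ U, ∃ N ∈ nhds y₀, ∃ b : State → ℝ, Integrable b stateMeasure ∧
    ∀ᵐ z ∂stateMeasure, ∀ y ∈ N,
      (1 + ‖z.1‖) * |Real.log (f y z)| * ‖fderiv ℝ (fun y' => f y' z) y‖ ≤ b z

end ESBGK

end

/-!
Everything rests on the Gibbs inequality. The function `s log s - s` is convex with derivative
`log s`, so for a positive `K` the entropy of `φ` is at least `⟨φ log K - K⟩`, with equality only if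
`φ = K`. If `K` is a Gaussian, `log K` is a combination of the weights `1`, `(v - u) ⊗ (v - u)`,
`I ^ (2 / δ)` and `i`, so the lower bound depends on `φ` through its moments only, and in an affine
way (`crossEntropy`). Explicit Gaussian, Gamma and geometric integrals give the moments of `K`
(`hasMoments_anisotropicGaussian`).

* If `φ` has the moments of `K`, the bound is the entropy of `K`: this is the entropy minimization
  (`extEntropy_anisotropicGaussian_le`). The negative part of the entropy density of `φ` is
  controlled by the integrable function `φ log K - K`, hence the extended entropy is meaningful.
* The entropy of a Gaussian, as a function of its moments, is the supremum of affine functions,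
  hence convex (`gaussEntropy_mix_le`). The moments of `𝓖[g]` are a convex combination of three
  families. Two of them are the equilibria of `g` with respect to all modes and to the translational
  and rotational modes; the logarithm of such an equilibrium depends on an energy which it shares
  with `g`, so that it has less entropy than `g`. In the third the stress tensor is
  `ν Θ + (1 - ν) tr Θ / 3`, which for `-1/2 ≤ ν ≤ 1` lies between `Θ` and `(tr Θ - Θ) / 2`; the
  second tensor has the larger determinant by the inequality of arithmetic and geometric means
  for the eigenvalues (`det_le_det_cyclicMean`), hence the smaller Gaussian entropy. Altogether
  `ℍ(𝓖[g]) ≤ ℍ(g)` (`entropy_gaussian_le`).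
* A classical solution `g` is positive, since at a zero its derivatives vanish whereas `𝓖[g] > 0`
  (`IsClassicalSolution.ae_pos`). So `g log g - g` is differentiable in `(t, x)`, and dominated
  convergence gives the entropy balance. The tangent inequality at `g` bounds the dissipation
  `⟨(𝓖[g] - g) log g⟩` by `ℍ(𝓖[g]) - ℍ(g) ≤ 0`.
* If `g = 𝓖[g]`, comparing moments gives linear relations between the temperatures which, for
  `Γ > 0`, force them all to equal `T_eq`, and the stress tensor to be isotropic.
-/

namespace ESBGK

open Matrix

/-! ### Positive definite tensors -/

/-- For a positive definite `3 × 3` matrix, `x ⬝ A x < tr A |x|²` if `x ≠ 0`: the difference is the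
sum of the values of `A` on the vector products of `x` with the basis vectors. -/
theorem posDef_trace_smul_one_sub {A : Matrix (Fin 3) (Fin 3) ℝ} (hA : A.PosDef) :
    (A.trace • (1 : Matrix (Fin 3) (Fin 3) ℝ) - A).PosDef := by
  have hsymm : ∀ i j, A i j = A j i := fun i j => by simpa using (hA.isHermitian.apply i j).symm
  refine PosDef.of_dotProduct_mulVec_pos ?_ fun {x} hx => ?_
  · ext i j
    fin_cases i <;> fin_cases j <;> simp [hsymm]
  have key : star x ⬝ᵥ ((A.trace • (1 : Matrix (Fin 3) (Fin 3) ℝ) - A) *ᵥ x) =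
      star ![0, -x 2, x 1] ⬝ᵥ (A *ᵥ ![0, -x 2, x 1]) +
      star ![x 2, 0, -x 0] ⬝ᵥ (A *ᵥ ![x 2, 0, -x 0]) +
      star ![-x 1, x 0, 0] ⬝ᵥ (A *ᵥ ![-x 1, x 0, 0]) := by
    simp [dotProduct, mulVec, Fin.sum_univ_three, trace, one_apply]
    ring
  have h0 := hA.posSemidef.dotProduct_mulVec_nonneg ![0, -x 2, x 1]
  have h1 := hA.posSemidef.dotProduct_mulVec_nonneg ![x 2, 0, -x 0]
  have h2 := hA.posSemidef.dotProduct_mulVec_nonneg ![-x 1, x 0, 0]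
  rw [key]
  by_cases hx0 : x 0 = 0
  · have : ![0, -x 2, x 1] ≠ 0 := by
      intro h
      apply hx
      have h3 := congrFun h 1
      have h4 := congrFun h 2
      ext i
      fin_cases i <;> simp_all
    have := hA.dotProduct_mulVec_pos this
    linarith
  · have : ![x 2, 0, -x 0] ≠ 0 := fun h => hx0 (by simpa using congrFun h 2)
    have := hA.dotProduct_mulVec_pos this
    linarith

/-- Half of `tr A - A`. In an eigenbasis of `A` it is the mean of the two matrices obtained from
`A` by permuting the eigenvalues cyclically. -/
noncomputable def cyclicMean (A : Matrix (Fin 3) (Fin 3) ℝ) : Matrix (Fin 3) (Fin 3) ℝ :=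
  (1 / 2 : ℝ) • (A.trace • (1 : Matrix (Fin 3) (Fin 3) ℝ) - A)

theorem posDef_cyclicMean {A : Matrix (Fin 3) (Fin 3) ℝ} (hA : A.PosDef) :
    (cyclicMean A).PosDef :=
  (posDef_trace_smul_one_sub hA).smul (by norm_num)

theorem det_le_det_cyclicMean {A : Matrix (Fin 3) (Fin 3) ℝ} (hA : A.PosDef) :
    A.det ≤ (cyclicMean A).det := by
  have h1 : (A.trace • (1 : Matrix (Fin 3) (Fin 3) ℝ) - A).det =
      ∏ i, (A.trace - hA.isHermitian.eigenvalues i) := by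
    have := congrArg (Polynomial.eval A.trace) hA.isHermitian.charpoly_eq
    rw [Matrix.eval_charpoly, Polynomial.eval_prod] at this
    simpa [Matrix.smul_one_eq_diagonal, Matrix.scalar_apply] using this
  have h2 := hA.isHermitian.det_eq_prod_eigenvalues
  have h3 := hA.isHermitian.trace_eq_sum_eigenvalues
  have p0 := hA.eigenvalues_pos 0
  have p1 := hA.eigenvalues_pos 1
  have p2 := hA.eigenvalues_pos 2
  rw [cyclicMean, det_smul, h1, h2, h3]
  simp only [Fin.sum_univ_three, Fin.prod_univ_three, RCLike.ofReal_real_eq_id, id,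
    Fintype.card_fin]
  generalize hA.isHermitian.eigenvalues 0 = a at *
  generalize hA.isHermitian.eigenvalues 1 = b at *
  generalize hA.isHermitian.eigenvalues 2 = c at *
  nlinarith [mul_nonneg p0.le (sq_nonneg (b - c)), mul_nonneg p1.le (sq_nonneg (a - c)),
    mul_nonneg p2.le (sq_nonneg (a - b))]

/-- For `ν ∈ [-1/2, 1]` the tensor `ν A + (1 - ν) (tr A / 3)` is a convex combination of `A` and
`cyclicMean A`. -/
theorem relaxedTensor_eq (A : Matrix (Fin 3) (Fin 3) ℝ) (ν m : ℝ) (hm : A.trace = 3 * m) :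
    ν • A + ((1 - ν) * m) • (1 : Matrix (Fin 3) (Fin 3) ℝ) =
      (2 / 3 * (1 - ν)) • cyclicMean A + (1 - 2 / 3 * (1 - ν)) • A := by
  rw [cyclicMean, hm]
  ext i j
  simp only [Matrix.add_apply, Matrix.smul_apply, Matrix.sub_apply, smul_eq_mul]
  ring

theorem posDef_relaxedTensor {A : Matrix (Fin 3) (Fin 3) ℝ} (hA : A.PosDef) {ν m : ℝ}
    (hν : -1 / 2 ≤ ν) (hν' : ν < 1) (hm : A.trace = 3 * m) :
    (ν • A + ((1 - ν) * m) • (1 : Matrix (Fin 3) (Fin 3) ℝ)).PosDef := by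
  rw [relaxedTensor_eq A ν m hm]
  exact ((posDef_cyclicMean hA).smul (by linarith)).add_posSemidef
    (hA.posSemidef.smul (by linarith))

theorem posDef_correctedTensor (P : Params) (hR : 0 < P.R)
    (hν : -1 / 2 ≤ P.ν) (hν' : P.ν < 1) (hθ : 0 ≤ P.θ) (hθ' : P.θ < 1)
    (hΓ : 0 ≤ P.Γ) (hΓ' : P.Γ < 1) {Θ : Matrix (Fin 3) (Fin 3) ℝ} {Ttr Ttrrot Teq : ℝ}
    (hΘ : Θ.PosDef) (htr : Θ.trace = 3 * P.R * Ttr) (hTtrrot : 0 < Ttrrot) (hTeq : 0 < Teq) :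
    (correctedTensor P Θ Ttr Ttrrot Teq).PosDef := by
  have h1 := posDef_relaxedTensor hΘ (m := P.R * Ttr) hν hν' (by rw [htr]; ring)
  rw [← mul_assoc] at h1
  have h2 : (1 : Matrix (Fin 3) (Fin 3) ℝ).PosSemidef := PosSemidef.one
  refine PosDef.posSemidef_add (h2.smul (by positivity)) (PosDef.smul
    (PosDef.posSemidef_add (h2.smul (by positivity)) (h1.smul ?_)) ?_) <;> linarith

/-! ### Gaussian integrals over velocity space -/

theorem integrable_pow_mul_exp_neg_half_sq (n : ℕ) :
    Integrable fun t : ℝ => t ^ n * Real.exp (-(1 / 2) * t ^ 2) := by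
  simpa using integrable_rpow_mul_exp_neg_mul_sq (b := 1 / 2) (by norm_num) (s := n)
    (by have := n.cast_nonneg (α := ℝ); linarith)

theorem integral_mul_exp_neg_half_sq (f : ℝ → ℝ) :
    ∫ t, f t * Real.exp (-(1 / 2) * t ^ 2) =
      Real.sqrt (2 * Real.pi) * ∫ t, f t ∂ProbabilityTheory.gaussianReal 0 1 := by
  rw [ProbabilityTheory.integral_gaussianReal_eq_integral_smul one_ne_zero, ← integral_const_mul]
  congr 1 with t
  have : Real.sqrt (2 * Real.pi) ≠ 0 := by positivity
  simp only [ProbabilityTheory.gaussianPDFReal, NNReal.coe_one, mul_one, sub_zero, smul_eq_mul]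
  field_simp

theorem integral_sq_gaussianReal : ∫ t, t ^ 2 ∂ProbabilityTheory.gaussianReal 0 1 = 1 := by
  have := ProbabilityTheory.variance_fun_id_gaussianReal (μ := 0) (v := 1)
  rw [ProbabilityTheory.variance_eq_integral measurable_id'.aemeasurable] at this
  simpa [ProbabilityTheory.integral_id_gaussianReal] using this

/-- Moments of order at most two of the standard Gaussian on the line. -/
theorem integral_pow_mul_exp_neg_half_sq {n : ℕ} (hn : n ≤ 2) :
    ∫ t : ℝ, t ^ n * Real.exp (-(1 / 2) * t ^ 2) =
      Real.sqrt (2 * Real.pi) * if n = 1 then 0 else 1 := by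
  rw [integral_mul_exp_neg_half_sq]
  interval_cases n
  · simp
  · simp [ProbabilityTheory.integral_id_gaussianReal]
  · simp [integral_sq_gaussianReal]

theorem prod_pow_mul_exp_neg_half_sq (α : Fin 3 → ℕ) (x : Fin 3 → ℝ) :
    ∏ i, (x i ^ α i * Real.exp (-(1 / 2) * x i ^ 2)) =
      (∏ i, x i ^ α i) * Real.exp (-(1 / 2) * ∑ i, x i ^ 2) := by
  rw [Finset.prod_mul_distrib, ← Real.exp_sum, Finset.mul_sum]

theorem integrable_monomial_mul_exp (α : Fin 3 → ℕ) :
    Integrable fun x : V => (∏ i, x i ^ α i) * Real.exp (-(1 / 2) * ∑ i, x i ^ 2) := by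
  have h := Integrable.fintype_prod (f := fun i (t : ℝ) => t ^ α i * Real.exp (-(1 / 2) * t ^ 2))
    (μ := fun _ : Fin 3 => (volume : Measure ℝ)) fun i => integrable_pow_mul_exp_neg_half_sq (α i)
  simp only [prod_pow_mul_exp_neg_half_sq] at h
  exact (EuclideanSpace.volume_preserving_symm_measurableEquiv_toLp (Fin 3)).integrable_comp_emb
    (MeasurableEquiv.measurableEmbedding _) |>.2 h

theorem integral_monomial_mul_exp (α : Fin 3 → ℕ) (hα : ∀ i, α i ≤ 2) :
    ∫ x : V, (∏ i, x i ^ α i) * Real.exp (-(1 / 2) * ∑ i, x i ^ 2) =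
      Real.sqrt (2 * Real.pi) ^ 3 * ∏ i, if α i = 1 then (0 : ℝ) else 1 := by
  have h := integral_fintype_prod_volume_eq_prod (ι := Fin 3) (𝕜 := ℝ)
    (fun i (t : ℝ) => t ^ α i * Real.exp (-(1 / 2) * t ^ 2))
  simp only [prod_pow_mul_exp_neg_half_sq] at h
  refine ((EuclideanSpace.volume_preserving_symm_measurableEquiv_toLp (Fin 3)).integral_comp
    (MeasurableEquiv.measurableEmbedding _) (fun x : Fin 3 → ℝ => (∏ i, x i ^ α i) *
      Real.exp (-(1 / 2) * ∑ i, x i ^ 2))).trans (h.trans ?_)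
  rw [Finset.prod_congr rfl fun i _ => integral_pow_mul_exp_neg_half_sq (hα i),
    Finset.prod_mul_distrib]
  simp

/-- Linear change of variables in velocity space. -/
theorem integrable_and_integral_comp_toEuclideanLin {B : Matrix (Fin 3) (Fin 3) ℝ}
    (hB : B.det ≠ 0) {F : V → ℝ} (hF : Continuous F)
    (h : Integrable fun x : V => F (B.toEuclideanLin x)) :
    Integrable F ∧ ∫ w, F w = |B.det| * ∫ x, F (B.toEuclideanLin x) := by
  have hdet : LinearMap.det (B.toEuclideanLin : V →ₗ[ℝ] V) = B.det := by
    rw [Matrix.toEuclideanLin_eq_toLin_orthonormal, LinearMap.det_toLin]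
  have hmap := Measure.map_linearMap_addHaar_eq_smul_addHaar (volume : Measure V)
    (f := B.toEuclideanLin) (by rwa [hdet])
  rw [hdet] at hmap
  have hm : AEMeasurable (B.toEuclideanLin : V → V) volume :=
    (LinearMap.continuous_of_finiteDimensional _).aemeasurable
  have hpos : 0 < |B.det| := abs_pos.2 hB
  constructor
  · have := (integrable_map_measure hF.aestronglyMeasurable hm).2 h
    rw [hmap] at this
    exact (integrable_smul_measure (by simpa using hB) ENNReal.ofReal_ne_top).1 this
  · have := integral_map hm (f := F) hF.aestronglyMeasurable
    rw [hmap, integral_smul_measure, ENNReal.toReal_ofReal (abs_nonneg _), abs_inv] at this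
    rw [← this, smul_eq_mul, mul_inv_cancel_left₀ hpos.ne']

/-- The Gaussian weight `exp (-w ⬝ S⁻¹ w / 2)` with covariance tensor `S`. -/
noncomputable def gaussWeight (S : Matrix (Fin 3) (Fin 3) ℝ) (w : Fin 3 → ℝ) : ℝ :=
  Real.exp (-(1 / 2) * (w ⬝ᵥ S⁻¹ *ᵥ w))

theorem continuous_gaussWeight (S : Matrix (Fin 3) (Fin 3) ℝ) :
    Continuous (gaussWeight S) := by
  unfold gaussWeight
  fun_prop

theorem exists_sqrt {S : Matrix (Fin 3) (Fin 3) ℝ} (hS : S.PosDef) :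
    ∃ B : Matrix (Fin 3) (Fin 3) ℝ, Bᵀ = B ∧ B * B = S := by
  open scoped MatrixOrder in
  have h0 : 0 ≤ S := Matrix.nonneg_iff_posSemidef.2 hS.posSemidef
  have h1 := (Matrix.nonneg_iff_posSemidef.1 (CFC.sqrt_nonneg S)).isHermitian
  exact ⟨CFC.sqrt S, by simpa [IsHermitian] using h1, CFC.sqrt_mul_sqrt_self S h0⟩

theorem gaussWeight_mul_self {B : Matrix (Fin 3) (Fin 3) ℝ} (hB : Bᵀ = B) (hdet : B.det ≠ 0)
    (x : Fin 3 → ℝ) : gaussWeight (B * B) (B *ᵥ x) = Real.exp (-(1 / 2) * ∑ i, x i ^ 2) := by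
  have hu : IsUnit B.det := hdet.isUnit
  have : (B *ᵥ x) ⬝ᵥ ((B * B)⁻¹ *ᵥ (B *ᵥ x)) = ∑ i, x i ^ 2 := by
    rw [mulVec_mulVec, Matrix.mul_inv_rev, Matrix.mul_assoc, Matrix.nonsing_inv_mul _ hu,
      Matrix.mul_one, dotProduct_mulVec, ← mulVec_transpose, mulVec_mulVec, transpose_nonsing_inv, hB,
      Matrix.nonsing_inv_mul _ hu, one_mulVec]
    simp [dotProduct, sq]
  rw [gaussWeight, this]

theorem toEuclideanLin_apply_eq (B : Matrix (Fin 3) (Fin 3) ℝ) (x : V) (j : Fin 3) :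
    (B.toEuclideanLin x) j = ∑ l, B j l * x l := by
  simp [Matrix.toEuclideanLin, mulVec, dotProduct]

section Moments

variable {S : Matrix (Fin 3) (Fin 3) ℝ}

/-- A function of the form `p(w) exp (-w ⬝ S⁻¹ w / 2)` is integrated by the substitution
`w = S^{1/2} x`. -/
theorem integrable_and_integral_mul_gaussWeight (hS : S.PosDef) :
    ∃ B : Matrix (Fin 3) (Fin 3) ℝ, Bᵀ = B ∧ B * B = S ∧ ∀ p : V → ℝ, Continuous p →
      Integrable (fun x : V => p (B.toEuclideanLin x) * Real.exp (-(1 / 2) * ∑ i, x i ^ 2)) →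
      Integrable (fun w : V => p w * gaussWeight S w) ∧
      ∫ w : V, p w * gaussWeight S w = Real.sqrt S.det *
        ∫ x : V, p (B.toEuclideanLin x) * Real.exp (-(1 / 2) * ∑ i, x i ^ 2) := by
  obtain ⟨B, hB, rfl⟩ := exists_sqrt hS
  have hdet : B.det ≠ 0 := fun h => hS.det_pos.ne' (by rw [det_mul, h, zero_mul])
  refine ⟨B, hB, rfl, fun p hp hint => ?_⟩
  have hF : Continuous fun w : V => p w * gaussWeight (B * B) w :=
    hp.mul ((continuous_gaussWeight _).comp (by fun_prop))
  have hcomp : ∀ x : V, gaussWeight (B * B) (B.toEuclideanLin x) =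
      Real.exp (-(1 / 2) * ∑ i, x i ^ 2) := fun x => by
    rw [← gaussWeight_mul_self hB hdet]
    congr 1
  have := integrable_and_integral_comp_toEuclideanLin hdet hF (by simpa only [hcomp] using hint)
  simpa only [hcomp, det_mul, Real.sqrt_mul_self_eq_abs] using this

theorem integrable_gaussWeight (hS : S.PosDef) :
    Integrable (fun w : V => gaussWeight S w) ∧
      ∫ w : V, gaussWeight S w = Real.sqrt ((2 * Real.pi) • S).det := by
  obtain ⟨B, -, -, h⟩ := integrable_and_integral_mul_gaussWeight hS
  have h0 := h (fun _ => 1) continuous_const (by simpa using integrable_monomial_mul_exp 0)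
  have h1 := integral_monomial_mul_exp 0 (by simp)
  simp only [Pi.zero_apply, pow_zero, Finset.prod_const_one, one_mul] at h0 h1
  refine ⟨h0.1, h0.2.trans ?_⟩
  have h2 : (2 * Real.pi) ^ 3 = (Real.sqrt (2 * Real.pi) ^ 3) ^ 2 := by
    rw [← pow_mul, mul_comm 3 2, pow_mul, Real.sq_sqrt (by positivity)]
  rw [h1, det_smul, Fintype.card_fin, h2, Real.sqrt_mul (sq_nonneg _),
    Real.sqrt_sq (by positivity)]
  simp only [zero_ne_one, if_false, Finset.prod_const_one, mul_one]
  ring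

theorem integrable_coord_mul_gaussWeight (hS : S.PosDef) (j : Fin 3) :
    Integrable (fun w : V => w j * gaussWeight S w) ∧ ∫ w : V, w j * gaussWeight S w = 0 := by
  obtain ⟨B, -, -, h⟩ := integrable_and_integral_mul_gaussWeight hS
  have hm : ∀ l, Integrable (fun x : V => x l * Real.exp (-(1 / 2) * ∑ i, x i ^ 2)) ∧
      ∫ x : V, x l * Real.exp (-(1 / 2) * ∑ i, x i ^ 2) = 0 := fun l => by
    have h1 := integrable_monomial_mul_exp (Pi.single l 1)
    have h2 := integral_monomial_mul_exp (Pi.single l 1)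
      (fun i => by by_cases h : i = l <;> simp [h])
    have h3 : ∀ x : V, ∏ i, x i ^ (Pi.single l 1 : Fin 3 → ℕ) i = x l := fun x => by
      rw [Finset.prod_eq_single l] <;> simp +contextual
    simp only [h3] at h1 h2
    refine ⟨h1, h2.trans ?_⟩
    rw [Finset.prod_eq_zero (Finset.mem_univ l) (by simp), mul_zero]
  have hcont : Continuous fun w : V => w j := by fun_prop
  have := h (fun w => w j) hcont (by
    simp only [toEuclideanLin_apply_eq, Finset.sum_mul, mul_assoc]
    exact integrable_finsetSum _ fun l _ => (hm l).1.const_mul _)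
  refine ⟨this.1, this.2.trans ?_⟩
  simp only [toEuclideanLin_apply_eq, Finset.sum_mul, mul_assoc]
  rw [integral_finsetSum _ fun l _ => (hm l).1.const_mul _]
  simp only [integral_const_mul, (hm _).2, mul_zero, Finset.sum_const_zero]

theorem integrable_coord_mul_coord_mul_gaussWeight (hS : S.PosDef) (j k : Fin 3) :
    Integrable (fun w : V => w j * w k * gaussWeight S w) ∧
      ∫ w : V, w j * w k * gaussWeight S w = S j k * Real.sqrt ((2 * Real.pi) • S).det := by
  have hmass := (integrable_gaussWeight hS).2
  obtain ⟨B, hB, hBS, h⟩ := integrable_and_integral_mul_gaussWeight hS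
  have h0 := (h (fun _ => 1) continuous_const (by simpa using integrable_monomial_mul_exp 0)).2
  have h1 := integral_monomial_mul_exp 0 (by simp)
  simp only [Pi.zero_apply, pow_zero, Finset.prod_const_one, one_mul, zero_ne_one, if_false,
    mul_one] at h0 h1
  have hm : ∀ l m, Integrable (fun x : V => x l * x m * Real.exp (-(1 / 2) * ∑ i, x i ^ 2)) ∧
      ∫ x : V, x l * x m * Real.exp (-(1 / 2) * ∑ i, x i ^ 2) =
        Real.sqrt (2 * Real.pi) ^ 3 * if l = m then 1 else 0 := fun l m => by
    have h1 := integrable_monomial_mul_exp (Pi.single l 1 + Pi.single m 1)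
    have h2 := integral_monomial_mul_exp (Pi.single l 1 + Pi.single m 1)
      (fun i => by simp only [Pi.add_apply, Pi.single_apply]; split_ifs <;> simp)
    have h3 : ∀ x : V, ∏ i, x i ^ (Pi.single l 1 + Pi.single m 1 : Fin 3 → ℕ) i = x l * x m :=
      fun x => by
        simp only [Pi.add_apply, pow_add, Finset.prod_mul_distrib]
        rw [Finset.prod_eq_single l, Finset.prod_eq_single m] <;>
          simp +contextual
    simp only [h3] at h1 h2
    refine ⟨h1, h2.trans ?_⟩
    split_ifs with hlm
    · subst hlm
      rw [Finset.prod_eq_one]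
      intro i _
      rw [if_neg]
      simp only [Pi.add_apply, Pi.single_apply]
      split_ifs <;> simp
    · rw [Finset.prod_eq_zero (Finset.mem_univ l)]
      simp [hlm]
  have hcont : Continuous fun w : V => w j * w k := by fun_prop
  have hexp : ∀ x : V, (∑ l, B j l * x l) * (∑ m, B k m * x m) *
      Real.exp (-(1 / 2) * ∑ i, x i ^ 2) =
      ∑ l, ∑ m, B j l * B k m * (x l * x m * Real.exp (-(1 / 2) * ∑ i, x i ^ 2)) := fun x => by
    rw [Finset.sum_mul_sum, Finset.sum_mul]
    refine Finset.sum_congr rfl fun l _ => ?_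
    rw [Finset.sum_mul]
    exact Finset.sum_congr rfl fun m _ => by ring
  have := h (fun w => w j * w k) hcont (by
    simp only [toEuclideanLin_apply_eq, hexp]
    exact integrable_finsetSum _ fun l _ => integrable_finsetSum _ fun m _ =>
      (hm l m).1.const_mul _)
  refine ⟨this.1, this.2.trans ?_⟩
  simp only [toEuclideanLin_apply_eq, hexp]
  rw [integral_finsetSum _ fun l _ => integrable_finsetSum _ fun m _ => (hm l m).1.const_mul _]
  simp_rw [integral_finsetSum _ fun m _ => (hm _ m).1.const_mul _, integral_const_mul, hm]
  rw [← hmass, h0, h1, ← hBS]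
  have hsum : (B * B) j k = ∑ l, B j l * B k l := by
    rw [mul_apply]
    exact Finset.sum_congr rfl fun l _ => by rw [← transpose_apply B k l, hB]
  rw [hsum]
  simp only [mul_ite, mul_one, mul_zero, Finset.sum_ite_eq, Finset.mem_univ, if_true,
    Finset.sum_mul, Finset.mul_sum]
  exact Finset.sum_congr rfl fun l _ => by ring

end Moments

/-! ### Integrals over the internal energies -/

theorem integrableOn_exp_neg_rpow_div {δ a : ℝ} (hδ : 0 < δ) (ha : 0 < a) :
    IntegrableOn (fun x : ℝ => Real.exp (-(x ^ (2 / δ) / a))) (Set.Ioi 0) ∧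
      ∫ x in Set.Ioi (0 : ℝ), Real.exp (-(x ^ (2 / δ) / a)) =
        a ^ (δ / 2) * (δ / 2) * Real.Gamma (δ / 2) := by
  have h1 := integrableOn_rpow_mul_exp_neg_mul_rpow (s := 0) (p := 2 / δ) (b := a⁻¹)
    (by norm_num) (by positivity) (by positivity)
  have h2 := integral_rpow_mul_exp_neg_mul_rpow (q := 0) (p := 2 / δ) (b := a⁻¹)
    (by positivity) (by norm_num) (by positivity)
  have h3 : ∀ x : ℝ, -a⁻¹ * x ^ (2 / δ) = -(x ^ (2 / δ) / a) := fun x => by ring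
  simp only [Real.rpow_zero, one_mul, h3] at h1 h2
  refine ⟨h1, h2.trans ?_⟩
  rw [Real.inv_rpow ha.le, ← Real.rpow_neg ha.le]
  congr 2 <;> field_simp <;> ring_nf

theorem integrableOn_rpow_mul_exp_neg_rpow_div {δ a : ℝ} (hδ : 0 < δ) (ha : 0 < a) :
    IntegrableOn (fun x : ℝ => x ^ (2 / δ) * Real.exp (-(x ^ (2 / δ) / a))) (Set.Ioi 0) ∧
      ∫ x in Set.Ioi (0 : ℝ), x ^ (2 / δ) * Real.exp (-(x ^ (2 / δ) / a)) =
        (δ / 2 * a) * (a ^ (δ / 2) * (δ / 2) * Real.Gamma (δ / 2)) := by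
  have hp : 0 < 2 / δ := by positivity
  have h1 := integrableOn_rpow_mul_exp_neg_mul_rpow (s := 2 / δ) (p := 2 / δ) (b := a⁻¹)
    (by linarith) hp (by positivity)
  have h2 := integral_rpow_mul_exp_neg_mul_rpow (q := 2 / δ) (p := 2 / δ) (b := a⁻¹)
    hp (by linarith) (by positivity)
  have h3 : ∀ x : ℝ, -a⁻¹ * x ^ (2 / δ) = -(x ^ (2 / δ) / a) := fun x => by ring
  simp only [h3] at h1 h2
  refine ⟨h1, h2.trans ?_⟩
  have h4 : (2 / δ + 1) / (2 / δ) = δ / 2 + 1 := by field_simp; ring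
  have h5 : 1 / (2 / δ) = δ / 2 := by field_simp
  rw [Real.inv_rpow ha.le, ← Real.rpow_neg ha.le, neg_div, neg_neg, h4, h5,
    Real.rpow_add_one ha.ne', Real.Gamma_add_one (by positivity)]
  ring

theorem hasSum_exp_neg_mul {k : ℝ} (hk : 0 < k) :
    HasSum (fun i : ℕ => Real.exp (-(i * k))) (1 - Real.exp (-k))⁻¹ := by
  have h := hasSum_geometric_of_lt_one (Real.exp_pos (-k)).le (Real.exp_lt_one_iff.2 (by linarith))
  refine h.congr_fun fun i => ?_
  rw [← Real.exp_nat_mul]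
  congr 1
  ring

theorem hasSum_mul_exp_neg_mul {k : ℝ} (hk : 0 < k) :
    HasSum (fun i : ℕ => (i : ℝ) * Real.exp (-(i * k)))
      (1 / (Real.exp k - 1) * (1 - Real.exp (-k))⁻¹) := by
  have h1 : Real.exp (-k) < 1 := Real.exp_lt_one_iff.2 (by linarith)
  have h := hasSum_coe_mul_geometric_of_norm_lt_one (r := Real.exp (-k))
    (by rwa [Real.norm_of_nonneg (Real.exp_pos _).le])
  have h2 : ∀ i : ℕ, (i : ℝ) * Real.exp (-k) ^ i = i * Real.exp (-(i * k)) := fun i => by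
    rw [← Real.exp_nat_mul]
    congr 2
    ring
  simp only [h2] at h
  convert! h using 1
  have h3 : 1 - Real.exp (-k) ≠ 0 := by linarith
  have h4 : Real.exp k - 1 = Real.exp k * (1 - Real.exp (-k)) := by
    rw [mul_sub, ← Real.exp_add]; simp
  rw [h4, Real.exp_neg]
  rw [Real.exp_neg] at h3
  have := (Real.exp_pos k).ne'
  field_simp

theorem integrable_count_and_integral {f : ℕ → ℝ} {s : ℝ} (h : HasSum f s) :
    Integrable f Measure.count ∧ ∫ i, f i ∂Measure.count = s := by
  have hi : Integrable f Measure.count := integrable_count_iff.2 h.summable.norm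
  refine ⟨hi, ?_⟩
  rw [integral_countable hi]
  simpa [Measure.real] using h.tsum_eq

/-! ### Integrals over the microscopic states -/

theorem ae_pos_rotational : ∀ᵐ z ∂stateMeasure, 0 < z.2.1 := by
  have h1 : ∀ᵐ x ∂((volume : Measure ℝ).restrict (Set.Ioi 0)), 0 < x :=
    ae_restrict_mem measurableSet_Ioi
  have h2 := (Measure.quasiMeasurePreserving_fst (ν := (Measure.count : Measure ℕ))).ae h1
  exact (Measure.quasiMeasurePreserving_snd (μ := (volume : Measure V))).ae h2

theorem integrable_and_integral_prod_mul {p : V → ℝ} {r : ℝ → ℝ} {n : ℕ → ℝ} {s : ℝ}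
    (hp : Integrable p) (hr : IntegrableOn r (Set.Ioi 0)) (hn : HasSum n s) :
    Integrable (fun z : State => p z.1 * (r z.2.1 * n z.2.2)) stateMeasure ∧
      ∫ z, p z.1 * (r z.2.1 * n z.2.2) ∂stateMeasure =
        (∫ v, p v) * ((∫ x in Set.Ioi 0, r x) * s) := by
  obtain ⟨h1, h2⟩ := integrable_count_and_integral hn
  refine ⟨hp.mul_prod (hr.integrable.mul_prod h1), ?_⟩
  rw [← h2, ← integral_prod_mul r n]
  exact integral_prod_mul p (fun y : ℝ × ℕ => r y.1 * n y.2)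

variable (P : Params)

/-- The weight `1 + |v|² + I^{2/δ} + i` whose integral against a distribution is finite. -/
noncomputable def momentWeight (z : State) : ℝ := 1 + ‖z.1‖ ^ 2 + z.2.1 ^ (2 / P.δ) + (z.2.2 : ℝ)

variable {P}

theorem FiniteMoments.integrable_mul {φ : State → ℝ} (hφ : FiniteMoments P φ) {m : State → ℝ}
    (hm : Measurable m) (C : ℝ) (hC : ∀ z : State, 0 < z.2.1 → |m z| ≤ C * momentWeight P z) :
    Integrable (fun z => m z * φ z) stateMeasure := by
  refine (hφ.integrable.const_mul C).mono (hm.aestronglyMeasurable.mul hφ.meas) ?_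
  filter_upwards [ae_pos_rotational] with z hz
  rw [norm_mul, Real.norm_eq_abs, norm_mul, norm_mul, ← mul_assoc]
  refine mul_le_mul_of_nonneg_right ((hC z hz).trans ?_) (norm_nonneg _)
  rw [← norm_mul]
  exact le_abs_self _

theorem abs_coord_le_norm (v : V) (j : Fin 3) : |v j| ≤ ‖v‖ := by
  simpa using PiLp.norm_apply_le v j

theorem momentWeight_bounds {z : State} (hz : 0 < z.2.1) :
    1 ≤ momentWeight P z ∧ ‖z.1‖ ≤ momentWeight P z ∧ ‖z.1‖ ^ 2 ≤ momentWeight P z ∧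
      z.2.1 ^ (2 / P.δ) ≤ momentWeight P z ∧ (z.2.2 : ℝ) ≤ momentWeight P z := by
  have h1 := Real.rpow_nonneg hz.le (2 / P.δ)
  have h2 : (0 : ℝ) ≤ z.2.2 := Nat.cast_nonneg _
  unfold momentWeight
  refine ⟨?_, ?_, ?_, ?_, ?_⟩ <;> nlinarith [sq_nonneg (‖z.1‖ - 1), sq_nonneg ‖z.1‖]

namespace FiniteMoments

variable {φ : State → ℝ} (hφ : FiniteMoments P φ)
include hφ

theorem integrable_self : Integrable φ stateMeasure := by
  simpa using hφ.integrable_mul (m := fun _ => 1) measurable_const 1 fun z hz => by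
    simpa using (momentWeight_bounds (P := P) hz).1

theorem integrable_coord (j : Fin 3) : Integrable (fun z => z.1 j * φ z) stateMeasure :=
  hφ.integrable_mul (by fun_prop) 1 fun z hz => by
    rw [one_mul]
    exact (abs_coord_le_norm _ _).trans (momentWeight_bounds hz).2.1

theorem integrable_coord_mul_coord (j k : Fin 3) :
    Integrable (fun z => z.1 j * z.1 k * φ z) stateMeasure :=
  hφ.integrable_mul (by fun_prop) 1 fun z hz => by
    rw [one_mul, abs_mul]
    refine le_trans ?_ (momentWeight_bounds hz).2.2.1
    rw [sq]
    gcongr <;> exact abs_coord_le_norm _ _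

theorem integrable_rotational :
    Integrable (fun z => z.2.1 ^ (2 / P.δ) * φ z) stateMeasure :=
  hφ.integrable_mul (by fun_prop) 1 fun z hz => by
    rw [one_mul, abs_of_nonneg (Real.rpow_nonneg hz.le _)]
    exact (momentWeight_bounds hz).2.2.2.1

theorem integrable_vibrational : Integrable (fun z => (z.2.2 : ℝ) * φ z) stateMeasure :=
  hφ.integrable_mul (by fun_prop) 1 fun z hz => by
    rw [one_mul, abs_of_nonneg (Nat.cast_nonneg _)]
    exact (momentWeight_bounds hz).2.2.2.2

theorem integrable_centered (U : Fin 3 → ℝ) (j k : Fin 3) :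
    Integrable (fun z => (z.1 j - U j) * (z.1 k - U k) * φ z) stateMeasure := by
  have := ((hφ.integrable_coord_mul_coord j k).sub ((hφ.integrable_coord j).const_mul (U k))).sub
    (((hφ.integrable_coord k).const_mul (U j)).sub (hφ.integrable_self.const_mul (U j * U k)))
  refine this.congr (Filter.Eventually.of_forall fun z => ?_)
  simp only [Pi.sub_apply]
  ring

end FiniteMoments

/-! ### Gaussians -/

variable (P)

/-- The normalization factor of `anisotropicGaussian`. -/
noncomputable def gaussCoeff (ρ : ℝ) (S : Matrix (Fin 3) (Fin 3) ℝ) (a k : ℝ) : ℝ :=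
  ρ * (2 / P.δ) *
    (Lam P * (1 - Real.exp (-k)) / (Real.sqrt ((2 * Real.pi) • S).det * a ^ (P.δ / 2)))

/-- The Gaussian of density `ρ`, mean velocity `U`, covariance tensor `S`, rotational temperature
`a` and inverse vibrational temperature `k`; `a` stands for `R T_rot` and `k` for `T₀ / T_vib`. -/
noncomputable def anisotropicGaussian (ρ : ℝ) (U : Fin 3 → ℝ) (S : Matrix (Fin 3) (Fin 3) ℝ)
    (a k : ℝ) (z : State) : ℝ :=
  gaussCoeff P ρ S a k *
    Real.exp
      (-(1 / 2) * ((fun j => z.1 j - U j) ⬝ᵥ S⁻¹ *ᵥ (fun j => z.1 j - U j))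
        - z.2.1 ^ (2 / P.δ) / a - (z.2.2 : ℝ) * k)

theorem gaussian_eq_anisotropicGaussian (g : State → ℝ) :
    gaussian P g = anisotropicGaussian P (rho g) (u g) (piTensor P g) (P.R * TRotRel P g)
      (P.T₀ / TVibRel P g) := rfl

/-- The function `φ` has density `ρ`, and its second velocity moments centered at `U`, rotational
moment and vibrational moment are `ρ M`, `ρ b` and `ρ n`. The vibrational moment is that of the
level `i`, without the factor `R T₀`. -/
structure HasMoments (φ : State → ℝ) (ρ : ℝ) (U : Fin 3 → ℝ) (M : Matrix (Fin 3) (Fin 3) ℝ)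
    (b n : ℝ) : Prop where
  finiteMoments : FiniteMoments P φ
  mass : ∫ z, φ z ∂stateMeasure = ρ
  second : ∀ j k, ∫ z, (z.1 j - U j) * (z.1 k - U k) * φ z ∂stateMeasure = ρ * M j k
  rotational : ∫ z, z.2.1 ^ (2 / P.δ) * φ z ∂stateMeasure = ρ * b
  vibrational : ∫ z, (z.2.2 : ℝ) * φ z ∂stateMeasure = ρ * n

variable {P} {ρ a k : ℝ} {U : Fin 3 → ℝ} {S : Matrix (Fin 3) (Fin 3) ℝ}

theorem gaussCoeff_pos (hδ : 0 < P.δ) (hρ : 0 < ρ) (hS : S.PosDef) (ha : 0 < a) (hk : 0 < k) :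
    0 < gaussCoeff P ρ S a k := by
  have h1 : 0 < 1 - Real.exp (-k) := by
    have := Real.exp_lt_one_iff.2 (neg_lt_zero.2 hk)
    linarith
  have h2 : 0 < Lam P := one_div_pos.2 (Real.Gamma_pos_of_pos (by positivity))
  have h3 : 0 < ((2 * Real.pi) • S).det := (hS.smul (by positivity)).det_pos
  unfold gaussCoeff
  positivity

theorem anisotropicGaussian_pos (hδ : 0 < P.δ) (hρ : 0 < ρ) (hS : S.PosDef) (ha : 0 < a)
    (hk : 0 < k) (z : State) : 0 < anisotropicGaussian P ρ U S a k z :=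
  mul_pos (gaussCoeff_pos hδ hρ hS ha hk) (Real.exp_pos _)

theorem anisotropicGaussian_eq_prod (z : State) :
    anisotropicGaussian P ρ U S a k z = gaussCoeff P ρ S a k *
      (gaussWeight S (z.1 - WithLp.toLp 2 U : V) *
        (Real.exp (-(z.2.1 ^ (2 / P.δ) / a)) * Real.exp (-((z.2.2 : ℝ) * k)))) := by
  rw [anisotropicGaussian, gaussWeight, ← Real.exp_add, ← Real.exp_add]
  congr 2
  have : (z.1 - WithLp.toLp 2 U : V).ofLp = fun j => z.1 j - U j := by ext j; simp
  rw [this]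
  ring

theorem measurable_anisotropicGaussian : Measurable (anisotropicGaussian P ρ U S a k) := by
  have h : Measurable fun z : State => gaussWeight S (z.1 - WithLp.toLp 2 U : V) :=
    ((continuous_gaussWeight S).comp (by fun_prop)).measurable
  have : anisotropicGaussian P ρ U S a k = _ := funext anisotropicGaussian_eq_prod
  rw [this]
  fun_prop

/-- The normalization factor makes `anisotropicGaussian` a function of mass `ρ`. -/
theorem gaussCoeff_mul (hδ : 0 < P.δ) (hS : S.PosDef) (ha : 0 < a) (hk : 0 < k) :
    gaussCoeff P ρ S a k * (Real.sqrt ((2 * Real.pi) • S).det *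
      ((a ^ (P.δ / 2) * (P.δ / 2) * Real.Gamma (P.δ / 2)) * (1 - Real.exp (-k))⁻¹)) = ρ := by
  have h1 : 0 < 1 - Real.exp (-k) := by
    have := Real.exp_lt_one_iff.2 (neg_lt_zero.2 hk)
    linarith
  have h2 : 0 < Real.Gamma (P.δ / 2) := Real.Gamma_pos_of_pos (by positivity)
  have h3 : 0 < Real.sqrt ((2 * Real.pi) • S).det :=
    Real.sqrt_pos.2 (hS.smul (by positivity)).det_pos
  have h4 : 0 < a ^ (P.δ / 2) := by positivity
  unfold gaussCoeff Lam
  field_simp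

/-- Integrals of products of functions of the single variables against a Gaussian. -/
theorem integrable_and_integral_mul_anisotropicGaussian {p : V → ℝ} {r : ℝ → ℝ} {n : ℕ → ℝ} {s : ℝ}
    (hp : Integrable fun w : V => p w * gaussWeight S w)
    (hr : IntegrableOn (fun x => r x * Real.exp (-(x ^ (2 / P.δ) / a))) (Set.Ioi 0))
    (hn : HasSum (fun i : ℕ => n i * Real.exp (-(i * k))) s) :
    Integrable (fun z : State => p (z.1 - WithLp.toLp 2 U : V) * r z.2.1 * n z.2.2 *
      anisotropicGaussian P ρ U S a k z) stateMeasure ∧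
    ∫ z, p (z.1 - WithLp.toLp 2 U : V) * r z.2.1 * n z.2.2 *
      anisotropicGaussian P ρ U S a k z ∂stateMeasure =
      gaussCoeff P ρ S a k * ((∫ w : V, p w * gaussWeight S w) *
        ((∫ x in Set.Ioi (0 : ℝ), r x * Real.exp (-(x ^ (2 / P.δ) / a))) * s)) := by
  obtain ⟨h1, h2⟩ := integrable_and_integral_prod_mul
    (hp.comp_sub_right (WithLp.toLp 2 U : V)) hr hn
  rw [integral_sub_right_eq_self (fun w : V => p w * gaussWeight S w)] at h2
  have h3 : ∀ z : State, p (z.1 - WithLp.toLp 2 U : V) * r z.2.1 * n z.2.2 *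
      anisotropicGaussian P ρ U S a k z = gaussCoeff P ρ S a k *
      (p (z.1 - WithLp.toLp 2 U : V) * gaussWeight S (z.1 - WithLp.toLp 2 U : V) *
        (r z.2.1 * Real.exp (-(z.2.1 ^ (2 / P.δ) / a)) *
          (n z.2.2 * Real.exp (-((z.2.2 : ℝ) * k))))) := fun z => by
    rw [anisotropicGaussian_eq_prod]
    ring
  simp only [h3]
  exact ⟨h1.const_mul _, by rw [integral_const_mul, h2]⟩

section GaussianMoments

variable (hδ : 0 < P.δ) (hS : S.PosDef) (ha : 0 < a) (hk : 0 < k)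
include hδ hS ha hk

theorem integrable_and_integral_anisotropicGaussian :
    Integrable (anisotropicGaussian P ρ U S a k) stateMeasure ∧
      ∫ z, anisotropicGaussian P ρ U S a k z ∂stateMeasure = ρ := by
  have h := integrable_and_integral_mul_anisotropicGaussian (P := P) (S := S) (a := a) (k := k)
    (U := U) (ρ := ρ) (p := fun _ => 1) (r := fun _ => 1) (n := fun _ => 1)
    (by simpa using (integrable_gaussWeight hS).1)
    (by simpa using (integrableOn_exp_neg_rpow_div hδ ha).1) (by simpa using hasSum_exp_neg_mul hk)
  simp only [one_mul, (integrable_gaussWeight hS).2, (integrableOn_exp_neg_rpow_div hδ ha).2,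
    gaussCoeff_mul hδ hS ha hk] at h
  exact h

theorem integrable_and_integral_coord_anisotropicGaussian (j : Fin 3) :
    Integrable (fun z => (z.1 j - U j) * anisotropicGaussian P ρ U S a k z) stateMeasure ∧
      ∫ z, (z.1 j - U j) * anisotropicGaussian P ρ U S a k z ∂stateMeasure = 0 := by
  have h := integrable_and_integral_mul_anisotropicGaussian (P := P) (S := S) (a := a) (k := k)
    (U := U) (ρ := ρ) (p := fun w => w j) (r := fun _ => 1) (n := fun _ => 1)
    (integrable_coord_mul_gaussWeight hS j).1
    (by simpa using (integrableOn_exp_neg_rpow_div hδ ha).1) (by simpa using hasSum_exp_neg_mul hk)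
  simpa only [mul_one, (integrable_coord_mul_gaussWeight hS j).2, zero_mul, mul_zero,
    PiLp.sub_apply] using h

theorem integrable_and_integral_coord_mul_coord_anisotropicGaussian (j l : Fin 3) :
    Integrable (fun z => (z.1 j - U j) * (z.1 l - U l) * anisotropicGaussian P ρ U S a k z)
      stateMeasure ∧
      ∫ z, (z.1 j - U j) * (z.1 l - U l) * anisotropicGaussian P ρ U S a k z ∂stateMeasure
        = ρ * S j l := by
  have h := integrable_and_integral_mul_anisotropicGaussian (P := P) (S := S) (a := a) (k := k)
    (U := U) (ρ := ρ) (p := fun w => w j * w l) (r := fun _ => 1) (n := fun _ => 1)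
    (integrable_coord_mul_coord_mul_gaussWeight hS j l).1
    (by simpa using (integrableOn_exp_neg_rpow_div hδ ha).1) (by simpa using hasSum_exp_neg_mul hk)
  simp only [mul_one, one_mul, (integrable_coord_mul_coord_mul_gaussWeight hS j l).2,
    (integrableOn_exp_neg_rpow_div hδ ha).2, PiLp.sub_apply] at h
  refine ⟨h.1, h.2.trans ?_⟩
  conv_rhs => rw [← gaussCoeff_mul (ρ := ρ) hδ hS ha hk]
  ring

theorem integrable_and_integral_rotational_anisotropicGaussian :
    Integrable (fun z => z.2.1 ^ (2 / P.δ) * anisotropicGaussian P ρ U S a k z) stateMeasure ∧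
      ∫ z, z.2.1 ^ (2 / P.δ) * anisotropicGaussian P ρ U S a k z ∂stateMeasure
        = ρ * (P.δ / 2 * a) := by
  have h := integrable_and_integral_mul_anisotropicGaussian (P := P) (S := S) (a := a) (k := k)
    (U := U) (ρ := ρ) (p := fun _ => 1) (r := fun x => x ^ (2 / P.δ)) (n := fun _ => 1)
    (by simpa using (integrable_gaussWeight hS).1)
    (integrableOn_rpow_mul_exp_neg_rpow_div hδ ha).1 (by simpa using hasSum_exp_neg_mul hk)
  simp only [one_mul, mul_one, (integrable_gaussWeight hS).2,
    (integrableOn_rpow_mul_exp_neg_rpow_div hδ ha).2] at h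
  refine ⟨h.1, h.2.trans ?_⟩
  conv_rhs => rw [← gaussCoeff_mul (ρ := ρ) hδ hS ha hk]
  ring

theorem integrable_and_integral_vibrational_anisotropicGaussian :
    Integrable (fun z => (z.2.2 : ℝ) * anisotropicGaussian P ρ U S a k z) stateMeasure ∧
      ∫ z, (z.2.2 : ℝ) * anisotropicGaussian P ρ U S a k z ∂stateMeasure
        = ρ * (1 / (Real.exp k - 1)) := by
  have h := integrable_and_integral_mul_anisotropicGaussian (P := P) (S := S) (a := a) (k := k)
    (U := U) (ρ := ρ) (p := fun _ => 1) (r := fun _ => 1) (n := fun i => (i : ℝ))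
    (by simpa using (integrable_gaussWeight hS).1)
    (by simpa using (integrableOn_exp_neg_rpow_div hδ ha).1) (hasSum_mul_exp_neg_mul hk)
  simp only [one_mul, mul_one, (integrable_gaussWeight hS).2,
    (integrableOn_exp_neg_rpow_div hδ ha).2] at h
  refine ⟨h.1, h.2.trans ?_⟩
  conv_rhs => rw [← gaussCoeff_mul (ρ := ρ) hδ hS ha hk]
  ring

theorem finiteMoments_anisotropicGaussian (hρ : 0 < ρ) :
    FiniteMoments P (anisotropicGaussian P ρ U S a k) := by
  refine ⟨measurable_anisotropicGaussian.aestronglyMeasurable,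
    Filter.Eventually.of_forall fun z => (anisotropicGaussian_pos hδ hρ hS ha hk z).le, ?_⟩
  have h0 := (integrable_and_integral_anisotropicGaussian (ρ := ρ) (U := U) hδ hS ha hk).1
  have h1 := fun j =>
    (integrable_and_integral_coord_anisotropicGaussian (ρ := ρ) (U := U) hδ hS ha hk j).1
  have h2 := fun j =>
    (integrable_and_integral_coord_mul_coord_anisotropicGaussian (ρ := ρ) (U := U)
      hδ hS ha hk j j).1
  have h3 := (integrable_and_integral_rotational_anisotropicGaussian
    (ρ := ρ) (U := U) hδ hS ha hk).1
  have h4 := (integrable_and_integral_vibrational_anisotropicGaussian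
    (ρ := ρ) (U := U) hδ hS ha hk).1
  refine (((h0.add (integrable_finsetSum Finset.univ fun j _ => ((h2 j).add
    ((h1 j).const_mul (2 * U j))).add (h0.const_mul (U j ^ 2)))).add h3).add h4).congr
      (Filter.Eventually.of_forall fun z => ?_)
  simp only [Pi.add_apply, EuclideanSpace.norm_sq_eq, Real.norm_eq_abs, sq_abs,
    Fin.sum_univ_three]
  ring

theorem hasMoments_anisotropicGaussian (hρ : 0 < ρ) :
    HasMoments P (anisotropicGaussian P ρ U S a k) ρ U S (P.δ / 2 * a) (1 / (Real.exp k - 1)) :=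
  ⟨finiteMoments_anisotropicGaussian hδ hS ha hk hρ,
    (integrable_and_integral_anisotropicGaussian hδ hS ha hk).2,
    fun j l => (integrable_and_integral_coord_mul_coord_anisotropicGaussian hδ hS ha hk j l).2,
    (integrable_and_integral_rotational_anisotropicGaussian hδ hS ha hk).2,
    (integrable_and_integral_vibrational_anisotropicGaussian hδ hS ha hk).2⟩

end GaussianMoments

/-! ### The Gibbs inequality -/

/-- The convex function `s log s - s` lies above its tangent at `t`, which is `s log t - t`. -/
theorem mul_log_sub_le_entropyDensity {s t : ℝ} (hs : 0 ≤ s) (ht : 0 < t) :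
    s * Real.log t - t ≤ entropyDensity s := by
  unfold entropyDensity
  rcases hs.eq_or_lt with rfl | hs
  · simpa using ht.le
  · have h := Real.log_le_sub_one_of_pos (div_pos ht hs)
    rw [Real.log_div ht.ne' hs.ne'] at h
    have := mul_le_mul_of_nonneg_left h hs.le
    rw [mul_sub, mul_sub, mul_div_cancel₀ _ hs.ne'] at this
    linarith

theorem eq_of_entropyDensity_eq {s t : ℝ} (hs : 0 ≤ s) (ht : 0 < t)
    (h : entropyDensity s = s * Real.log t - t) : s = t := by
  unfold entropyDensity at h
  rcases hs.eq_or_lt with rfl | hs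
  · simp only [zero_mul, sub_zero, zero_sub] at h
    linarith
  · by_contra hne
    have h1 := Real.log_lt_sub_one_of_pos (div_pos ht hs)
      (fun h2 => hne ((div_eq_one_iff_eq hs.ne').1 h2).symm)
    rw [Real.log_div ht.ne' hs.ne'] at h1
    have := mul_lt_mul_of_pos_left h1 hs
    rw [mul_sub, mul_sub, mul_div_cancel₀ _ hs.ne'] at this
    linarith

theorem measurable_entropyDensity : Measurable entropyDensity := by
  unfold entropyDensity
  fun_prop

section TangentBound

variable {φ G : State → ℝ}

/-- If `ℍ` is minorized on `φ` by an integrable function, then either `ℍ(φ) = +∞` or the entropy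
density of `φ` is integrable. -/
theorem extEntropy_eq_top_or_integrable (hφ : AEStronglyMeasurable φ stateMeasure) {l : State → ℝ}
    (hl : Integrable l stateMeasure) (hle : ∀ᵐ z ∂stateMeasure, l z ≤ entropyDensity (φ z)) :
    extEntropy φ = ⊤ ∨ Integrable (fun z => entropyDensity (φ z)) stateMeasure := by
  have hneg : (∫⁻ z, ENNReal.ofReal (-entropyDensity (φ z)) ∂stateMeasure) < ⊤ := by
    refine lt_of_le_of_lt (lintegral_mono_ae ?_) hl.neg.lintegral_lt_top
    filter_upwards [hle] with z hz
    exact ENNReal.ofReal_le_ofReal (by simpa using hz)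
  by_cases hpos : (∫⁻ z, ENNReal.ofReal (entropyDensity (φ z)) ∂stateMeasure) = ⊤
  · left
    rw [extEntropy, hpos]
    lift (∫⁻ z, ENNReal.ofReal (-entropyDensity (φ z)) ∂stateMeasure) to NNReal using hneg.ne with c
    exact EReal.top_sub_coe _
  · right
    have hm : AEStronglyMeasurable (fun z => entropyDensity (φ z)) stateMeasure :=
      (measurable_entropyDensity.comp_aemeasurable hφ.aemeasurable).aestronglyMeasurable
    refine ⟨hm, ?_⟩
    have h : ∀ z, ‖entropyDensity (φ z)‖ₑ = ENNReal.ofReal (entropyDensity (φ z)) +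
        ENNReal.ofReal (-entropyDensity (φ z)) := fun z => by
      rw [← ofReal_norm, Real.norm_eq_abs]
      rcases le_total 0 (entropyDensity (φ z)) with h | h
      · rw [abs_of_nonneg h, ENNReal.ofReal_of_nonpos (neg_nonpos.2 h), add_zero]
      · rw [abs_of_nonpos h, ENNReal.ofReal_of_nonpos h, zero_add]
    rw [HasFiniteIntegral, lintegral_congr h, lintegral_add_left' (by
      exact hm.aemeasurable.ennreal_ofReal)]
    exact ENNReal.add_lt_top.2 ⟨lt_top_iff_ne_top.2 hpos, hneg⟩

variable (hφ0 : ∀ᵐ z ∂stateMeasure, 0 ≤ φ z) (hG0 : ∀ z, 0 < G z)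
  (hG : Integrable G stateMeasure)
  (hφG : Integrable (fun z => φ z * Real.log (G z)) stateMeasure)
include hφ0 hG0 hG hφG

theorem integral_mul_log_sub_le_entropy
    (hφ : Integrable (fun z => entropyDensity (φ z)) stateMeasure) :
    ∫ z, φ z * Real.log (G z) ∂stateMeasure - ∫ z, G z ∂stateMeasure ≤ entropy φ := by
  rw [← integral_sub hφG hG]
  refine integral_mono_ae (hφG.sub hG) hφ ?_
  filter_upwards [hφ0] with z hz using mul_log_sub_le_entropyDensity hz (hG0 z)

/-- The Gibbs principle: if `log G` has the same integral against `φ` and against `G`, then `G` has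
less entropy than `φ`, strictly unless `φ = G`. -/
theorem extEntropy_le_of_integral_mul_log_eq (hφm : AEStronglyMeasurable φ stateMeasure)
    (hGG : Integrable (fun z => G z * Real.log (G z)) stateMeasure)
    (heq : ∫ z, φ z * Real.log (G z) ∂stateMeasure = ∫ z, G z * Real.log (G z) ∂stateMeasure) :
    extEntropy G ≤ extEntropy φ ∧ (extEntropy φ = extEntropy G → φ =ᵐ[stateMeasure] G) := by
  have hGe : Integrable (fun z => entropyDensity (G z)) stateMeasure := hGG.sub hG
  have hle : ∀ᵐ z ∂stateMeasure, φ z * Real.log (G z) - G z ≤ entropyDensity (φ z) := by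
    filter_upwards [hφ0] with z hz using mul_log_sub_le_entropyDensity hz (hG0 z)
  have hent : entropy G = ∫ z, (φ z * Real.log (G z) - G z) ∂stateMeasure := by
    rw [integral_sub hφG hG, heq, ← integral_sub hGG hG]
    rfl
  rcases extEntropy_eq_top_or_integrable hφm (hφG.sub hG) hle with h | h
  · rw [h, extEntropy_eq_entropy G hGe]
    exact ⟨le_top, fun h' => absurd h'.symm (EReal.coe_ne_top _)⟩
  · rw [extEntropy_eq_entropy G hGe, extEntropy_eq_entropy φ h, EReal.coe_le_coe_iff,
      EReal.coe_eq_coe_iff, hent]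
    refine ⟨integral_mono_ae (hφG.sub hG) h hle, fun h' => ?_⟩
    have h0 := (integral_eq_iff_of_ae_le (hφG.sub hG) h hle).1 h'.symm
    filter_upwards [h0, hφ0] with z hz hz0
    exact eq_of_entropyDensity_eq hz0 (hG0 z) hz.symm

end TangentBound

/-! ### Entropy of Gaussians -/

variable (P : Params)

/-- The integral of `φ log K - K` for the Gaussian `K` with parameters `ρ, S, a, k` and a function
`φ` of mass `ρ` with moments `M, b, n`, in the sense of `HasMoments`. It is affine in
`(M, b, n)`. -/
noncomputable def crossEntropy (ρ : ℝ) (S : Matrix (Fin 3) (Fin 3) ℝ) (a k : ℝ)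
    (M : Matrix (Fin 3) (Fin 3) ℝ) (b n : ℝ) : ℝ :=
  ρ * (Real.log (gaussCoeff P ρ S a k) - 1 / 2 * (∑ j, ∑ l, S⁻¹ j l * M j l) - b / a - n * k - 1)

variable {P} {ρ a k b n : ℝ} {U : Fin 3 → ℝ} {S M : Matrix (Fin 3) (Fin 3) ℝ}

theorem log_anisotropicGaussian (hC : 0 < gaussCoeff P ρ S a k) (z : State) :
    Real.log (anisotropicGaussian P ρ U S a k z) = Real.log (gaussCoeff P ρ S a k)
      - 1 / 2 * (∑ j, ∑ l, S⁻¹ j l * ((z.1 j - U j) * (z.1 l - U l)))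
      - z.2.1 ^ (2 / P.δ) / a - (z.2.2 : ℝ) * k := by
  rw [anisotropicGaussian, Real.log_mul hC.ne' (Real.exp_pos _).ne', Real.log_exp]
  have : (fun j => z.1 j - U j) ⬝ᵥ S⁻¹ *ᵥ (fun j => z.1 j - U j) =
      ∑ j, ∑ l, S⁻¹ j l * ((z.1 j - U j) * (z.1 l - U l)) := by
    simp only [dotProduct, mulVec, Finset.mul_sum]
    exact Finset.sum_congr rfl fun j _ => Finset.sum_congr rfl fun l _ => by ring
  rw [this]
  ring

theorem HasMoments.integrable_and_integral_mul_log {φ : State → ℝ}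
    (hφ : HasMoments P φ ρ U M b n) (hC : 0 < gaussCoeff P ρ S a k) :
    Integrable (fun z => φ z * Real.log (anisotropicGaussian P ρ U S a k z)) stateMeasure ∧
      ∫ z, φ z * Real.log (anisotropicGaussian P ρ U S a k z) ∂stateMeasure =
        crossEntropy P ρ S a k M b n + ρ := by
  have h0 := hφ.finiteMoments.integrable_self
  have h1 := fun j l => hφ.finiteMoments.integrable_centered U j l
  have h2 := hφ.finiteMoments.integrable_rotational
  have h3 := hφ.finiteMoments.integrable_vibrational
  have hs1 : ∀ j, Integrable (fun z : State => ∑ l, S⁻¹ j l *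
      ((z.1 j - U j) * (z.1 l - U l) * φ z)) stateMeasure := fun j =>
    integrable_finsetSum _ fun l _ => (h1 j l).const_mul _
  have hs : Integrable (fun z : State => ∑ j, ∑ l, S⁻¹ j l *
      ((z.1 j - U j) * (z.1 l - U l) * φ z)) stateMeasure :=
    integrable_finsetSum _ fun j _ => hs1 j
  have hpt : ∀ z, φ z * Real.log (anisotropicGaussian P ρ U S a k z) =
      Real.log (gaussCoeff P ρ S a k) * φ z
      - 1 / 2 * (∑ j, ∑ l, S⁻¹ j l * ((z.1 j - U j) * (z.1 l - U l) * φ z))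
      - a⁻¹ * (z.2.1 ^ (2 / P.δ) * φ z) - k * ((z.2.2 : ℝ) * φ z) := fun z => by
    have : ∑ j, ∑ l, S⁻¹ j l * ((z.1 j - U j) * (z.1 l - U l) * φ z) =
        (∑ j, ∑ l, S⁻¹ j l * ((z.1 j - U j) * (z.1 l - U l))) * φ z := by
      simp only [Finset.sum_mul, mul_assoc]
    rw [log_anisotropicGaussian hC, this]
    ring
  simp only [hpt]
  have hA := h0.const_mul (Real.log (gaussCoeff P ρ S a k))
  have hB := hs.const_mul (1 / 2)
  have hD := h2.const_mul a⁻¹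
  have hE := h3.const_mul k
  refine ⟨((hA.sub hB).sub hD).sub hE, ?_⟩
  have e1 := integral_sub ((hA.sub hB).sub hD) hE
  have e2 := integral_sub (hA.sub hB) hD
  have e3 := integral_sub hA hB
  simp only [Pi.sub_apply] at e1 e2 e3
  rw [e1, e2, e3]
  simp only [integral_const_mul, hφ.mass, hφ.rotational, hφ.vibrational]
  rw [integral_finsetSum _ fun j _ => hs1 j]
  simp_rw [integral_finsetSum _ fun l _ => (h1 _ l).const_mul _, integral_const_mul, hφ.second]
  have : ∑ j, ∑ l, S⁻¹ j l * (ρ * M j l) = ρ * ∑ j, ∑ l, S⁻¹ j l * M j l := by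
    simp only [Finset.mul_sum]
    exact Finset.sum_congr rfl fun j _ => Finset.sum_congr rfl fun l _ => by ring
  rw [this, crossEntropy]
  ring

section GaussianEntropy

variable (hδ : 0 < P.δ) (hρ : 0 < ρ) (hS : S.PosDef) (ha : 0 < a) (hk : 0 < k)
include hδ hρ hS ha hk

theorem crossEntropy_le_entropy {φ : State → ℝ} (hφ : HasMoments P φ ρ U M b n)
    (hφe : Integrable (fun z => entropyDensity (φ z)) stateMeasure) :
    crossEntropy P ρ S a k M b n ≤ entropy φ := by
  have hC := gaussCoeff_pos (P := P) hδ hρ hS ha hk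
  obtain ⟨h1, h2⟩ := hφ.integrable_and_integral_mul_log hC
  obtain ⟨h3, h4⟩ :=
    integrable_and_integral_anisotropicGaussian (P := P) (ρ := ρ) (U := U) hδ hS ha hk
  have := integral_mul_log_sub_le_entropy hφ.finiteMoments.nonneg
    (anisotropicGaussian_pos hδ hρ hS ha hk) h3 h1 hφe
  rw [h2, h4] at this
  linarith

theorem integrable_and_entropy_anisotropicGaussian :
    Integrable (fun z => entropyDensity (anisotropicGaussian P ρ U S a k z)) stateMeasure ∧
      entropy (anisotropicGaussian P ρ U S a k) =
        crossEntropy P ρ S a k S (P.δ / 2 * a) (1 / (Real.exp k - 1)) := by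
  have hC := gaussCoeff_pos (P := P) hδ hρ hS ha hk
  obtain ⟨h1, h2⟩ := (hasMoments_anisotropicGaussian (U := U)
    hδ hS ha hk hρ).integrable_and_integral_mul_log hC
  obtain ⟨h3, h4⟩ :=
    integrable_and_integral_anisotropicGaussian (P := P) (ρ := ρ) (U := U) hδ hS ha hk
  refine ⟨h1.sub h3, ?_⟩
  have := integral_sub h1 h3
  rw [h2, h4, add_sub_cancel_right] at this
  exact this

/-- A Gaussian is the only minimizer of the entropy among the functions with its moments. -/
theorem extEntropy_anisotropicGaussian_le {φ : State → ℝ}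
    (hφ : HasMoments P φ ρ U S (P.δ / 2 * a) (1 / (Real.exp k - 1))) :
    extEntropy (anisotropicGaussian P ρ U S a k) ≤ extEntropy φ ∧
      (extEntropy φ = extEntropy (anisotropicGaussian P ρ U S a k) →
        φ =ᵐ[stateMeasure] anisotropicGaussian P ρ U S a k) := by
  have hC := gaussCoeff_pos (P := P) hδ hρ hS ha hk
  obtain ⟨h1, h2⟩ := (hasMoments_anisotropicGaussian (U := U)
    hδ hS ha hk hρ).integrable_and_integral_mul_log hC
  obtain ⟨h3, h4⟩ := hφ.integrable_and_integral_mul_log hC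
  exact extEntropy_le_of_integral_mul_log_eq hφ.finiteMoments.nonneg
    (anisotropicGaussian_pos hδ hρ hS ha hk)
    (integrable_and_integral_anisotropicGaussian hδ hS ha hk).1 h3 hφ.finiteMoments.meas h1
    (h4.trans h2.symm)

end GaussianEntropy

/-! ### Energies and temperatures -/

section Temperatures

variable {P : Params} (hR : 0 < P.R) (hT₀ : 0 < P.T₀) (hδ : 0 < P.δ)

include hR hT₀ in
theorem eVib_pos {T : ℝ} (hT : 0 < T) : 0 < eVib P T := by
  have : 1 < Real.exp (P.T₀ / T) := Real.one_lt_exp_iff.2 (by positivity)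
  exact div_pos (by positivity) (by linarith)

include hR hT₀ in
theorem eVib_le {T : ℝ} (hT : 0 < T) : eVib P T ≤ P.R * T := by
  have h1 : P.T₀ / T ≤ Real.exp (P.T₀ / T) - 1 := by
    have := Real.add_one_le_exp (P.T₀ / T)
    linarith
  have h2 : 0 < P.T₀ / T := by positivity
  calc eVib P T ≤ P.R * P.T₀ / (P.T₀ / T) := by unfold eVib; gcongr
    _ = P.R * T := by field_simp

include hT₀ in
theorem continuousOn_eTot : ContinuousOn (eTot P) (Set.Ioi 0) := by
  unfold eTot eTr eRot eVib
  refine ContinuousOn.add (by fun_prop) (ContinuousOn.div (by fun_prop) ?_ ?_)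
  · refine ContinuousOn.sub (Real.continuous_exp.comp_continuousOn ?_) continuousOn_const
    exact continuousOn_const.div continuousOn_id fun T hT => (Set.mem_Ioi.1 hT).ne'
  · intro T hT
    have : 1 < Real.exp (P.T₀ / T) := Real.one_lt_exp_iff.2 (div_pos hT₀ hT)
    linarith

include hR hT₀ hδ

/-- Every positive total energy is attained, since `3/2 R T ≤ e(T) ≤ (5/2 + δ/2) R T`. -/
theorem eTotInv_spec {E : ℝ} (hE : 0 < E) : 0 < eTotInv P E ∧ eTot P (eTotInv P E) = E := by
  suffices h : ∃ T ∈ Set.Ioi 0, eTot P T = E from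
    ⟨Function.invFunOn_mem h, Function.invFunOn_eq h⟩
  set T₁ := E / ((5 / 2 + P.δ / 2) * P.R) with hT₁
  set T₂ := E / (3 / 2 * P.R) with hT₂
  have h1 : 0 < T₁ := by positivity
  have h12 : T₁ ≤ T₂ := by
    rw [hT₁, hT₂]
    gcongr
    linarith
  have h2 : 0 < T₂ := h1.trans_le h12
  have e1 : eTot P T₁ ≤ E := by
    have := eVib_le hR hT₀ h1
    have h3 : (5 / 2 + P.δ / 2) * P.R * T₁ = E := by rw [hT₁]; field_simp
    unfold eTot eTr eRot
    linarith
  have e2 : E ≤ eTot P T₂ := by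
    have := eVib_pos hR hT₀ h2
    have h3 : 3 / 2 * P.R * T₂ = E := by rw [hT₂]; field_simp
    have h4 : 0 < P.δ / 2 * P.R * T₂ := by positivity
    unfold eTot eTr eRot
    linarith
  obtain ⟨T, hT, hTE⟩ := intermediate_value_Icc h12
    ((continuousOn_eTot hT₀).mono fun T hT => Set.mem_Ioi.2 (h1.trans_le hT.1)) ⟨e1, e2⟩
  exact ⟨T, h1.trans_le hT.1, hTE⟩

omit hR hδ in
theorem div_eVibInv {E : ℝ} : P.T₀ / eVibInv P E = Real.log (1 + P.R * P.T₀ / E) := by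
  rw [eVibInv, div_div_cancel₀ hT₀.ne']

omit hδ in
theorem one_div_exp_div_eVibInv {E : ℝ} (hE : 0 < E) :
    1 / (Real.exp (P.T₀ / eVibInv P E) - 1) = E / (P.R * P.T₀) := by
  rw [div_eVibInv hT₀, Real.exp_log (by positivity)]
  field_simp
  ring

omit hδ in
theorem div_eVibInv_pos {E : ℝ} (hE : 0 < E) : 0 < P.T₀ / eVibInv P E := by
  rw [div_eVibInv hT₀]
  have : 0 < P.R * P.T₀ / E := by positivity
  exact Real.log_pos (by linarith)

omit hδ in
theorem eVibInv_eVib {T : ℝ} (hT : 0 < T) : eVibInv P (eVib P T) = T := by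
  have h1 : 1 < Real.exp (P.T₀ / T) := Real.one_lt_exp_iff.2 (by positivity)
  have h2 : 1 + P.R * P.T₀ / eVib P T = Real.exp (P.T₀ / T) := by
    have : Real.exp (P.T₀ / T) - 1 ≠ 0 := by linarith
    unfold eVib
    field_simp
    ring
  rw [eVibInv, h2, Real.log_exp, div_div_cancel₀ hT₀.ne']

end Temperatures

/-! ### Moments of a distribution -/

/-- A linear functional `x ⬝ (v - U)` with `x ≠ 0` vanishes only on a null set. -/
theorem ae_linear_ne_zero {x : Fin 3 → ℝ} (hx : x ≠ 0) (U : Fin 3 → ℝ) :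
    ∀ᵐ z ∂stateMeasure, ∑ j, x j * (z.1 j - U j) ≠ 0 := by
  have h : ∀ᵐ v ∂(volume : Measure V), ∑ j, x j * (v j - U j) ≠ 0 := by
    let L : V →ₗ[ℝ] ℝ := ∑ j, x j • (EuclideanSpace.proj j : V →L[ℝ] ℝ).toLinearMap
    have hL : ∀ w : V, L w = ∑ j, x j * w j := fun w => by simp [L]
    have hker : LinearMap.ker L ≠ ⊤ := by
      intro h
      apply hx
      ext j
      have := LinearMap.congr_fun (LinearMap.ker_eq_top.1 h) (EuclideanSpace.single j 1)
      simpa [hL] using this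
    have h0 := Measure.addHaar_submodule (volume : Measure V) _ hker
    rw [ae_iff]
    refine measure_mono_null (fun v hv => ?_)
      ((measure_preimage_add_right _ (-WithLp.toLp 2 U : V) _).trans h0)
    simpa [hL, sub_eq_add_neg] using hv
  exact (Measure.quasiMeasurePreserving_fst (μ := (volume : Measure V))).ae h

theorem rho_ne_zero {P : Params} {g : State → ℝ} (hg : IsDistribution P g) : rho g ≠ 0 :=
  hg.rho_pos.ne'

section Distribution

variable {P : Params} {g : State → ℝ} (hg : IsDistribution P g)
include hg

theorem IsDistribution.integral_mul_pos {m : State → ℝ} (hm : ∀ᵐ z ∂stateMeasure, 0 < m z)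
    (hi : Integrable (fun z => m z * g z) stateMeasure) :
    0 < (rho g)⁻¹ * ∫ z, m z * g z ∂stateMeasure := by
  refine mul_pos (inv_pos.2 hg.rho_pos) ?_
  have h0 : 0 ≤ᵐ[stateMeasure] fun z => m z * g z := by
    filter_upwards [hm, hg.finiteMoments.nonneg] with z h1 h2 using mul_nonneg h1.le h2
  refine lt_of_le_of_ne (integral_nonneg_of_ae h0) fun h => hg.rho_pos.ne' ?_
  refine integral_eq_zero_of_ae ?_
  filter_upwards [(integral_eq_zero_iff_of_nonneg_ae h0 hi).1 h.symm, hm] with z h1 h2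
  exact (mul_eq_zero.1 h1).resolve_left h2.ne'

theorem IsDistribution.hasMoments (hR : 0 < P.R) (hT₀ : 0 < P.T₀) :
    HasMoments P g (rho g) (u g) (stress g) (ERot P g) (EVib P g / (P.R * P.T₀)) := by
  have h := rho_ne_zero hg
  refine ⟨hg.finiteMoments, rfl, fun j k => ?_, ?_, ?_⟩
  · rw [stress, mul_inv_cancel_left₀ h]
  · rw [ERot, mul_inv_cancel_left₀ h]
  · have h1 : ∀ z : State, (z.2.2 : ℝ) * P.R * P.T₀ * g z = P.R * P.T₀ * ((z.2.2 : ℝ) * g z) :=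
      fun z => by ring
    rw [EVib]
    simp only [h1, integral_const_mul]
    field_simp

theorem IsDistribution.quadratic_stress (x : Fin 3 → ℝ) :
    x ⬝ᵥ stress g *ᵥ x =
      (rho g)⁻¹ * ∫ z, (∑ j, x j * (z.1 j - u g j)) ^ 2 * g z ∂stateMeasure := by
  have h1 := fun j k => hg.finiteMoments.integrable_centered (u g) j k
  have h2 : ∀ z, (∑ j, x j * (z.1 j - u g j)) ^ 2 * g z =
      ∑ j, ∑ k, x j * x k * ((z.1 j - u g j) * (z.1 k - u g k) * g z) := fun z => by
    rw [sq, Finset.sum_mul_sum, Finset.sum_mul]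
    refine Finset.sum_congr rfl fun j _ => ?_
    rw [Finset.sum_mul]
    exact Finset.sum_congr rfl fun k _ => by ring
  simp only [h2]
  rw [integral_finsetSum _ fun j _ => integrable_finsetSum _ fun k _ => (h1 j k).const_mul _]
  simp_rw [integral_finsetSum _ fun k _ => (h1 _ k).const_mul _, integral_const_mul]
  simp only [dotProduct, mulVec, stress, Finset.mul_sum]
  exact Finset.sum_congr rfl fun j _ => Finset.sum_congr rfl fun k _ => by ring

/-- A distribution has a positive definite stress tensor because it does not charge planes. -/
theorem IsDistribution.posDef_stress : (stress g).PosDef := by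
  refine PosDef.of_dotProduct_mulVec_pos ?_ fun {x} hx => ?_
  · ext j k
    simp only [conjTranspose_apply, stress, star_trivial]
    congr 2 with z
    ring
  · rw [star_trivial, hg.quadratic_stress]
    refine hg.integral_mul_pos ?_ ?_
    · filter_upwards [ae_linear_ne_zero hx (u g)] with z hz
      positivity
    · have h1 := fun j k => hg.finiteMoments.integrable_centered (u g) j k
      have h3 := integrable_finsetSum Finset.univ fun j _ =>
        integrable_finsetSum Finset.univ fun k _ => (h1 j k).const_mul (x j * x k)
      refine h3.congr (Filter.Eventually.of_forall fun z => ?_)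
      simp only
      rw [sq, Finset.sum_mul_sum, Finset.sum_mul]
      refine Finset.sum_congr rfl fun j _ => ?_
      rw [Finset.sum_mul]
      exact Finset.sum_congr rfl fun k _ => by ring

theorem IsDistribution.trace_stress : (stress g).trace = 2 * ETr g := by
  have h1 := fun j => hg.finiteMoments.integrable_centered (u g) j j
  have h2 : ∀ z, 1 / 2 * (∑ j, (z.1 j - u g j) ^ 2) * g z =
      1 / 2 * ∑ j, ((z.1 j - u g j) * (z.1 j - u g j) * g z) := fun z => by
    rw [← Finset.sum_mul, mul_assoc]
    simp only [sq]
  rw [ETr]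
  simp only [h2, integral_const_mul]
  rw [integral_finsetSum _ fun j _ => h1 j]
  simp only [trace, diag_apply, stress, ← Finset.mul_sum]
  ring

theorem IsDistribution.ETr_pos : 0 < ETr g := by
  have h := hg.posDef_stress.trace_pos
  rw [hg.trace_stress] at h
  linarith

theorem IsDistribution.ERot_pos : 0 < ERot P g := by
  refine hg.integral_mul_pos ?_ hg.finiteMoments.integrable_rotational
  filter_upwards [ae_pos_rotational] with z hz using Real.rpow_pos_of_pos hz _

theorem IsDistribution.EVib_nonneg (hR : 0 < P.R) (hT₀ : 0 < P.T₀) : 0 ≤ EVib P g := by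
  refine mul_nonneg (inv_pos.2 hg.rho_pos).le (integral_nonneg_of_ae ?_)
  filter_upwards [hg.finiteMoments.nonneg] with z hz
  positivity

/-- The vibrational energy vanishes only if the distribution is concentrated on `i = 0`. -/
theorem IsDistribution.EVib_pos (hR : 0 < P.R) (hT₀ : 0 < P.T₀)
    (hpos : ∀ᵐ z ∂stateMeasure, 0 < g z) : 0 < EVib P g := by
  refine lt_of_le_of_ne (hg.EVib_nonneg hR hT₀) fun h => ?_
  have h1 := (hg.hasMoments hR hT₀).vibrational
  rw [← h, zero_div, mul_zero, integral_eq_zero_iff_of_nonneg_ae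
    (by filter_upwards [hpos] with z hz using mul_nonneg (Nat.cast_nonneg _) hz.le)
    hg.finiteMoments.integrable_vibrational] at h1
  have h2 : ∀ᵐ z ∂stateMeasure, z.2.2 ≠ 1 := by
    filter_upwards [h1, hpos] with z hz hz' h3
    simp [h3, hz'.ne'] at hz
  rw [ae_iff] at h2
  have h3 : {z : State | ¬z.2.2 ≠ 1} = Set.univ ×ˢ (Set.univ ×ˢ {1}) := by
    ext z
    simp
  rw [h3, stateMeasure, Measure.prod_prod, Measure.prod_prod] at h2
  simp at h2

variable (hR : 0 < P.R) (hT₀ : 0 < P.T₀) (hδ : 0 < P.δ)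
include hR

theorem IsDistribution.trace_stress_eq_TTr : (stress g).trace = 3 * P.R * TTr P g := by
  rw [hg.trace_stress, TTr, eTrInv]
  field_simp

include hδ

theorem IsDistribution.TTrRot_pos : 0 < TTrRot P g :=
  mul_pos (by positivity) (add_pos hg.ETr_pos hg.ERot_pos)

include hT₀

theorem IsDistribution.TEq_spec : 0 < TEq P g ∧ eTot P (TEq P g) = ETot P g :=
  eTotInv_spec hR hT₀ hδ (add_pos_of_pos_of_nonneg (add_pos hg.ETr_pos hg.ERot_pos)
    (hg.EVib_nonneg hR hT₀))

theorem IsDistribution.eRotRel_pos (hθ : 0 ≤ P.θ) (hθ' : P.θ < 1)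
    (hΓ : 0 ≤ P.Γ) (hΓ' : P.Γ < 1) : 0 < eRotRel P g := by
  have h1 : 0 < eRot P (TEq P g) :=
    mul_pos (by positivity) (hg.TEq_spec hR hT₀ hδ).1
  have h2 : 0 < eRot P (TTrRot P g) := mul_pos (by positivity) (hg.TTrRot_pos hR hδ)
  have h3 := hg.ERot_pos
  have h4 : 0 < 1 - P.Γ := by linarith
  have h5 : 0 < 1 - P.θ := by linarith
  unfold eRotRel
  positivity

theorem IsDistribution.posDef_piTensor (hν : -1 / 2 ≤ P.ν) (hν' : P.ν < 1) (hθ : 0 ≤ P.θ)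
    (hθ' : P.θ < 1) (hΓ : 0 ≤ P.Γ) (hΓ' : P.Γ < 1) : (piTensor P g).PosDef :=
  posDef_correctedTensor P hR hν hν' hθ hθ' hΓ hΓ' hg.posDef_stress (hg.trace_stress_eq_TTr hR)
    (hg.TTrRot_pos hR hδ) (hg.TEq_spec hR hT₀ hδ).1

end Distribution

theorem half_mul_TRotRel {P : Params} (hR : 0 < P.R) (hδ : 0 < P.δ) (g : State → ℝ) :
    P.δ / 2 * (P.R * TRotRel P g) = eRotRel P g := by
  rw [TRotRel, eRotInv]
  field_simp

theorem FiniteMoments.integral_centered {P : Params} {φ : State → ℝ} (h0 : FiniteMoments P φ)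
    (U : Fin 3 → ℝ) (j k : Fin 3) :
    ∫ z, (z.1 j - U j) * (z.1 k - U k) * φ z ∂stateMeasure =
      ∫ z, z.1 j * z.1 k * φ z ∂stateMeasure - U k * ∫ z, z.1 j * φ z ∂stateMeasure -
        (U j * ∫ z, z.1 k * φ z ∂stateMeasure - U j * U k * ∫ z, φ z ∂stateMeasure) := by
  have hexp : ∀ z, (z.1 j - U j) * (z.1 k - U k) * φ z =
      (z.1 j * z.1 k * φ z - U k * (z.1 j * φ z)) -
        (U j * (z.1 k * φ z) - U j * U k * φ z) := fun z => by ring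
  have i1 := h0.integrable_coord_mul_coord j k
  have i2 := (h0.integrable_coord j).const_mul (U k)
  have i3 := (h0.integrable_coord k).const_mul (U j)
  have i4 := h0.integrable_self.const_mul (U j * U k)
  have e1 := integral_sub (i1.sub i2) (i3.sub i4)
  simp only [Pi.sub_apply] at e1
  simp only [hexp]
  rw [e1, integral_sub i1 i2, integral_sub i3 i4]
  simp only [integral_const_mul]

/-- A function in the set on which the entropy is minimized has the moments of `𝓖[g]`, centered
at the mean velocity. -/
theorem hasMoments_of_mem_momentSet {P : Params} (hR : 0 < P.R) (hT₀ : 0 < P.T₀) {g φ : State → ℝ}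
    (hφ : φ ∈ momentSet P g) :
    HasMoments P φ (rho g) (u g) (piTensor P g) (eRotRel P g) (eVibRel P g / (P.R * P.T₀)) := by
  obtain ⟨h0, h1, h2, h3, h4, h5⟩ := hφ
  refine ⟨h0, h1, fun j k => ?_, h4, ?_⟩
  · rw [h0.integral_centered, h1, h2, h2, h3]
    ring
  · have hexp : ∀ z : State, (z.2.2 : ℝ) * P.R * P.T₀ * φ z = P.R * P.T₀ * ((z.2.2 : ℝ) * φ z) :=
      fun z => by ring
    simp only [hexp, integral_const_mul] at h5
    rw [mul_div_assoc', eq_div_iff (by positivity), ← h5]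
    ring

theorem gaussian_mem_momentSet {P : Params} (hR : 0 < P.R) (hT₀ : 0 < P.T₀) {g : State → ℝ}
    (hδ : 0 < P.δ) (hρ : 0 < rho g) (hS : (piTensor P g).PosDef) (ha : 0 < P.R * TRotRel P g)
    (hv : 0 < eVibRel P g) : gaussian P g ∈ momentSet P g := by
  have hk : 0 < P.T₀ / TVibRel P g := div_eVibInv_pos hR hT₀ hv
  have hm := hasMoments_anisotropicGaussian (U := u g) hδ hS ha hk hρ
  have hfirst := fun j => (integrable_and_integral_coord_anisotropicGaussian (U := u g) (ρ := rho g)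
    hδ hS ha hk j).2
  rw [← gaussian_eq_anisotropicGaussian] at hm
  simp only [← gaussian_eq_anisotropicGaussian] at hfirst
  have h0 := hm.finiteMoments
  have h1 := hm.mass
  have hcoord : ∀ j, ∫ z, z.1 j * gaussian P g z ∂stateMeasure = rho g * u g j := fun j => by
    have := hfirst j
    simp only [sub_mul] at this
    rw [integral_sub (h0.integrable_coord j) (h0.integrable_self.const_mul _),
      integral_const_mul, h1] at this
    linarith
  refine ⟨h0, h1, hcoord, fun j k => ?_, ?_, ?_⟩
  · have hs := hm.second j k
    rw [h0.integral_centered, h1, hcoord, hcoord] at hs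
    linarith
  · rw [hm.rotational, half_mul_TRotRel hR hδ]
  · have hexp : ∀ z : State, (z.2.2 : ℝ) * P.R * P.T₀ * gaussian P g z =
        P.R * P.T₀ * ((z.2.2 : ℝ) * gaussian P g z) := fun z => by ring
    simp only [hexp, integral_const_mul]
    rw [hm.vibrational, TVibRel, one_div_exp_div_eVibInv hR hT₀ hv]
    field_simp

/-! ### Relaxation decreases the entropy -/

/-- Entropy of the Gaussian of density `ρ` with second moments `S`, rotational moment `b` and
vibrational moment `n`, in the sense of `HasMoments`. -/
noncomputable def gaussEntropy (P : Params) (ρ : ℝ) (S : Matrix (Fin 3) (Fin 3) ℝ) (b n : ℝ) : ℝ :=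
  crossEntropy P ρ S (2 / P.δ * b) (Real.log (1 + 1 / n)) S b n

section GaussEntropy

variable {P : Params} {ρ b n b' n' : ℝ} {S S' : Matrix (Fin 3) (Fin 3) ℝ}

theorem log_one_add_one_div_pos (hn : 0 < n) : 0 < Real.log (1 + 1 / n) := by
  have : 0 < 1 / n := by positivity
  exact Real.log_pos (by linarith)

theorem one_div_exp_log_sub_one (hn : 0 < n) : 1 / (Real.exp (Real.log (1 + 1 / n)) - 1) = n := by
  rw [Real.exp_log (by positivity)]
  simp

theorem crossEntropy_mix (a k c : ℝ) (M M' : Matrix (Fin 3) (Fin 3) ℝ) :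
    crossEntropy P ρ S a k (c • M + (1 - c) • M') (c * b + (1 - c) * b') (c * n + (1 - c) * n') =
      c * crossEntropy P ρ S a k M b n + (1 - c) * crossEntropy P ρ S a k M' b' n' := by
  have : ∑ j, ∑ l, S⁻¹ j l * (c • M + (1 - c) • M') j l =
      c * (∑ j, ∑ l, S⁻¹ j l * M j l) + (1 - c) * ∑ j, ∑ l, S⁻¹ j l * M' j l := by
    simp only [Matrix.add_apply, Matrix.smul_apply, smul_eq_mul, Finset.mul_sum,
      ← Finset.sum_add_distrib]
    exact Finset.sum_congr rfl fun j _ => Finset.sum_congr rfl fun l _ => by ring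
  rw [crossEntropy, this, crossEntropy, crossEntropy]
  ring

theorem posDef_mix {c : ℝ} (hc : 0 ≤ c) (hc' : c ≤ 1) (hS : S.PosDef) (hS' : S'.PosDef) :
    (c • S + (1 - c) • S').PosDef := by
  rcases hc.eq_or_lt with rfl | hc
  · simpa using hS'
  · exact (hS.smul hc).add_posSemidef (hS'.posSemidef.smul (by linarith))

theorem mix_pos {c x y : ℝ} (hc : 0 ≤ c) (hc' : c ≤ 1) (hx : 0 < x) (hy : 0 < y) :
    0 < c * x + (1 - c) * y := by
  rcases hc.eq_or_lt with rfl | hc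
  · simpa using hy
  · have : 0 ≤ (1 - c) * y := mul_nonneg (by linarith) hy.le
    have := mul_pos hc hx
    linarith

/-- The pairing of the inverse of a symmetric matrix with the matrix itself. -/
theorem sum_inv_mul_self (hS : S.PosDef) : ∑ j, ∑ l, S⁻¹ j l * S j l = 3 := by
  have hsymm : ∀ j l, S j l = S l j := fun j l => by simpa using (hS.isHermitian.apply j l).symm
  have h := congrArg trace (Matrix.nonsing_inv_mul S hS.det_pos.ne'.isUnit)
  simp only [trace, diag_apply, mul_apply, one_apply_eq, Finset.sum_const, Finset.card_univ,
    Fintype.card_fin] at h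
  calc ∑ j, ∑ l, S⁻¹ j l * S j l = ∑ j, ∑ l, S⁻¹ j l * S l j :=
        Finset.sum_congr rfl fun j _ => Finset.sum_congr rfl fun l _ => by rw [hsymm]
    _ = 3 := by rw [h]; norm_num

theorem crossEntropy_isotropic {τ : ℝ} (hτ : 0 < τ) (a k : ℝ) (M : Matrix (Fin 3) (Fin 3) ℝ) :
    crossEntropy P ρ (τ • (1 : Matrix (Fin 3) (Fin 3) ℝ)) a k M b n =
      ρ * (Real.log (gaussCoeff P ρ (τ • (1 : Matrix (Fin 3) (Fin 3) ℝ)) a k)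
        - 1 / 2 * M.trace / τ - b / a - n * k - 1) := by
  have hinv : (τ • (1 : Matrix (Fin 3) (Fin 3) ℝ))⁻¹ = τ⁻¹ • (1 : Matrix (Fin 3) (Fin 3) ℝ) := by
    refine Matrix.inv_eq_left_inv ?_
    rw [smul_mul_smul_comm, Matrix.one_mul, inv_mul_cancel₀ hτ.ne', one_smul]
  rw [crossEntropy, hinv]
  simp [trace, one_apply, Fin.sum_univ_three]
  left
  ring

variable (hδ : 0 < P.δ) (hρ : 0 < ρ) (hS : S.PosDef) (hb : 0 < b) (hn : 0 < n)
include hδ hρ hS hb hn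

theorem crossEntropy_le_entropy_of_hasMoments {φ : State → ℝ} {U : Fin 3 → ℝ}
    (hφ : HasMoments P φ ρ U S' b' n')
    (hφe : Integrable (fun z => entropyDensity (φ z)) stateMeasure) :
    crossEntropy P ρ S (2 / P.δ * b) (Real.log (1 + 1 / n)) S' b' n' ≤ entropy φ :=
  crossEntropy_le_entropy hδ hρ hS (by positivity) (log_one_add_one_div_pos hn) hφ hφe

theorem integrable_and_entropy_eq_gaussEntropy (U : Fin 3 → ℝ) :
    Integrable (fun z => entropyDensity (anisotropicGaussian P ρ U S (2 / P.δ * b)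
        (Real.log (1 + 1 / n)) z)) stateMeasure ∧
      entropy (anisotropicGaussian P ρ U S (2 / P.δ * b) (Real.log (1 + 1 / n))) =
        gaussEntropy P ρ S b n := by
  have h := integrable_and_entropy_anisotropicGaussian (U := U) hδ hρ hS
    (show 0 < 2 / P.δ * b by positivity) (log_one_add_one_div_pos hn)
  rwa [one_div_exp_log_sub_one hn, show P.δ / 2 * (2 / P.δ * b) = b by field_simp] at h

theorem gaussEntropy_le_entropy {φ : State → ℝ} {U : Fin 3 → ℝ} (hφ : HasMoments P φ ρ U S b n)
    (hφe : Integrable (fun z => entropyDensity (φ z)) stateMeasure) :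
    gaussEntropy P ρ S b n ≤ entropy φ :=
  crossEntropy_le_entropy_of_hasMoments hδ hρ hS hb hn hφ hφe

theorem crossEntropy_le_gaussEntropy (hS' : S'.PosDef) (hb' : 0 < b') (hn' : 0 < n') :
    crossEntropy P ρ S (2 / P.δ * b) (Real.log (1 + 1 / n)) S' b' n' ≤
      gaussEntropy P ρ S' b' n' := by
  have hm := hasMoments_anisotropicGaussian (U := 0) hδ hS'
    (show 0 < 2 / P.δ * b' by positivity) (log_one_add_one_div_pos hn') hρ
  rw [one_div_exp_log_sub_one hn', show P.δ / 2 * (2 / P.δ * b') = b' by field_simp] at hm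
  obtain ⟨h1, h2⟩ := integrable_and_entropy_eq_gaussEntropy hδ hρ hS' hb' hn' 0
  rw [← h2]
  exact crossEntropy_le_entropy_of_hasMoments hδ hρ hS hb hn hm h1

/-- The entropy of Gaussians is a convex function of their moments; by the Gibbs inequality it is
the supremum of the affine functions `crossEntropy`. -/
theorem gaussEntropy_mix_le (hS' : S'.PosDef) (hb' : 0 < b') (hn' : 0 < n') {c h : ℝ} (hc : 0 ≤ c)
    (hc' : c ≤ 1) (h1 : gaussEntropy P ρ S b n ≤ h) (h2 : gaussEntropy P ρ S' b' n' ≤ h) :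
    gaussEntropy P ρ (c • S + (1 - c) • S') (c * b + (1 - c) * b') (c * n + (1 - c) * n') ≤ h := by
  have hM := posDef_mix hc hc' hS hS'
  have hB := mix_pos hc hc' hb hb'
  have hN := mix_pos hc hc' hn hn'
  have e1 := (crossEntropy_le_gaussEntropy hδ hρ hM hB hN hS hb hn).trans h1
  have e2 := (crossEntropy_le_gaussEntropy hδ hρ hM hB hN hS' hb' hn').trans h2
  rw [gaussEntropy, crossEntropy_mix]
  nlinarith [mul_le_mul_of_nonneg_left e1 hc, mul_le_mul_of_nonneg_left e2 (sub_nonneg.2 hc')]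

theorem gaussEntropy_cyclicMean_le :
    gaussEntropy P ρ (cyclicMean S) b n ≤ gaussEntropy P ρ S b n := by
  have hC := posDef_cyclicMean hS
  have hk := log_one_add_one_div_pos hn
  have ha : 0 < 2 / P.δ * b := by positivity
  have hcoeff : gaussCoeff P ρ (cyclicMean S) (2 / P.δ * b) (Real.log (1 + 1 / n)) ≤
      gaussCoeff P ρ S (2 / P.δ * b) (Real.log (1 + 1 / n)) := by
    have h1 : 0 < ((2 * Real.pi) • S).det := (hS.smul (by positivity)).det_pos
    have h2 : ((2 * Real.pi) • S).det ≤ ((2 * Real.pi) • cyclicMean S).det := by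
      rw [det_smul, det_smul]
      exact mul_le_mul_of_nonneg_left (det_le_det_cyclicMean hS) (by positivity)
    have h3 : 0 < Lam P := one_div_pos.2 (Real.Gamma_pos_of_pos (by positivity))
    have h4 : 0 < 1 - Real.exp (-Real.log (1 + 1 / n)) := by
      have := Real.exp_lt_one_iff.2 (neg_lt_zero.2 hk)
      linarith
    unfold gaussCoeff
    gcongr
  have := Real.log_le_log (gaussCoeff_pos hδ hρ hC ha hk) hcoeff
  rw [gaussEntropy, gaussEntropy, crossEntropy, crossEntropy, sum_inv_mul_self hS,
    sum_inv_mul_self hC]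
  gcongr

end GaussEntropy

theorem gaussian_eq_anisotropicGaussian_moments {P : Params} (hR : 0 < P.R) (hT₀ : 0 < P.T₀)
    (hδ : 0 < P.δ) (g : State → ℝ) :
    gaussian P g = anisotropicGaussian P (rho g) (u g) (piTensor P g) (2 / P.δ * eRotRel P g)
      (Real.log (1 + 1 / (eVibRel P g / (P.R * P.T₀)))) := by
  have h1 : P.R * TRotRel P g = 2 / P.δ * eRotRel P g := by
    rw [TRotRel, eRotInv]
    field_simp
  rw [gaussian_eq_anisotropicGaussian, h1, TVibRel, div_eVibInv hT₀, one_div_div]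

theorem log_one_add_one_div_eVib {P : Params} (hR : 0 < P.R) (hT₀ : 0 < P.T₀) {T : ℝ} (hT : 0 < T) :
    Real.log (1 + 1 / (eVib P T / (P.R * P.T₀))) = P.T₀ / T := by
  rw [one_div_div, ← div_eVibInv hT₀, eVibInv_eVib hR hT₀ hT]

/-- The moments of `𝓖[g]` are a convex combination of those of three Gaussians of entropy at most
`ℍ(g)`: the equilibrium of all modes, the equilibrium of the translational and rotational modes,
and the Gaussian in which only the stress tensor is relaxed. -/
theorem entropy_gaussian_le {P : Params} (hR : 0 < P.R) (hT₀ : 0 < P.T₀) (hδ : 0 < P.δ)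
    (hν : -1 / 2 ≤ P.ν) (hν' : P.ν < 1) (hθ : 0 ≤ P.θ) (hθ' : P.θ < 1)
    (hΓ : 0 ≤ P.Γ) (hΓ' : P.Γ < 1) {g : State → ℝ} (hg : IsDistribution P g)
    (hvib : 0 < EVib P g) (hent : Integrable (fun z => entropyDensity (g z)) stateMeasure) :
    Integrable (fun z => entropyDensity (gaussian P g z)) stateMeasure ∧
      entropy (gaussian P g) ≤ entropy g := by
  have hρ := hg.rho_pos
  have hS := hg.posDef_stress
  have hb := hg.ERot_pos
  have hn : 0 < EVib P g / (P.R * P.T₀) := by positivity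
  have hm := hg.hasMoments hR hT₀
  have htr := hg.trace_stress_eq_TTr hR
  have hTr := hg.TTrRot_pos hR hδ
  obtain ⟨hTe, hTeE⟩ := hg.TEq_spec hR hT₀ hδ
  have hVe := eVib_pos hR hT₀ hTe
  have hone : (1 : Matrix (Fin 3) (Fin 3) ℝ).PosDef := PosDef.one
  have htrace : ∀ τ : ℝ, (τ • (1 : Matrix (Fin 3) (Fin 3) ℝ)).trace = 3 * τ := fun τ => by
    simp [trace_smul, mul_comm]
  have hrot : ∀ T, 2 / P.δ * eRot P T = P.R * T := fun T => by
    rw [eRot]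
    field_simp
  have hrotpos : ∀ T, 0 < T → 0 < eRot P T := fun T hT => mul_pos (by positivity) hT
  -- relaxation of the stress tensor at fixed rotational and vibrational energies
  have h3 : gaussEntropy P (rho g)
      (P.ν • stress g + ((1 - P.ν) * P.R * TTr P g) • (1 : Matrix (Fin 3) (Fin 3) ℝ))
      (ERot P g) (EVib P g / (P.R * P.T₀)) ≤ entropy g := by
    have hΘ := gaussEntropy_le_entropy hδ hρ hS hb hn hm hent
    have hC := (gaussEntropy_cyclicMean_le hδ hρ hS hb hn).trans hΘ
    have := gaussEntropy_mix_le hδ hρ (posDef_cyclicMean hS) hb hn hS hb hn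
      (c := 2 / 3 * (1 - P.ν)) (by linarith) (by linarith) hC hΘ
    have hc : ∀ x : ℝ, 2 / 3 * (1 - P.ν) * x + (1 - 2 / 3 * (1 - P.ν)) * x = x := fun x => by ring
    rwa [← relaxedTensor_eq (stress g) P.ν (P.R * TTr P g) (by rw [htr]; ring), hc, hc,
      ← mul_assoc] at this
  have hpos3 := posDef_relaxedTensor hS (m := P.R * TTr P g) hν hν' (by rw [htr]; ring)
  rw [← mul_assoc] at hpos3
  -- equilibrium between the translational and rotational modes
  have h2 : gaussEntropy P (rho g) ((P.R * TTrRot P g) • (1 : Matrix (Fin 3) (Fin 3) ℝ))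
      (eRot P (TTrRot P g)) (EVib P g / (P.R * P.T₀)) ≤ entropy g := by
    refine le_trans (le_of_eq ?_) (crossEntropy_le_entropy_of_hasMoments hδ hρ
      (hone.smul (show 0 < P.R * TTrRot P g by positivity)) (hrotpos _ hTr) hn hm hent)
    have he : ETr g + ERot P g = (3 + P.δ) / 2 * P.R * TTrRot P g := by
      rw [TTrRot, eTrRotInv]
      field_simp
    rw [gaussEntropy, crossEntropy_isotropic (by positivity),
      crossEntropy_isotropic (by positivity), hrot, htrace, hg.trace_stress, eRot]
    have hne : P.R * TTrRot P g ≠ 0 := by positivity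
    have : 1 / 2 * (3 * (P.R * TTrRot P g)) / (P.R * TTrRot P g) +
        P.δ / 2 * P.R * TTrRot P g / (P.R * TTrRot P g) =
        1 / 2 * (2 * ETr g) / (P.R * TTrRot P g) + ERot P g / (P.R * TTrRot P g) := by
      rw [← add_div, ← add_div]
      congr 1
      linarith
    congr 1
    linarith
  -- equilibrium between all modes
  have h1 : gaussEntropy P (rho g) ((P.R * TEq P g) • (1 : Matrix (Fin 3) (Fin 3) ℝ))
      (eRot P (TEq P g)) (eVib P (TEq P g) / (P.R * P.T₀)) ≤ entropy g := by
    have hne : 0 < eVib P (TEq P g) / (P.R * P.T₀) := by positivity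
    refine le_trans (le_of_eq ?_) (crossEntropy_le_entropy_of_hasMoments hδ hρ
      (hone.smul (show 0 < P.R * TEq P g by positivity)) (hrotpos _ hTe) hne hm hent)
    rw [gaussEntropy, crossEntropy_isotropic (by positivity),
      crossEntropy_isotropic (by positivity), hrot, htrace, hg.trace_stress,
      log_one_add_one_div_eVib hR hT₀ hTe]
    have hk : ∀ x, x / (P.R * P.T₀) * (P.T₀ / TEq P g) = x / (P.R * TEq P g) := fun x => by
      field_simp
    rw [hk, hk]
    have : 1 / 2 * (3 * (P.R * TEq P g)) / (P.R * TEq P g) +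
        eRot P (TEq P g) / (P.R * TEq P g) + eVib P (TEq P g) / (P.R * TEq P g) =
        1 / 2 * (2 * ETr g) / (P.R * TEq P g) + ERot P g / (P.R * TEq P g) +
          EVib P g / (P.R * TEq P g) := by
      simp only [← add_div]
      congr 1
      rw [eTot, eTr, ETot] at hTeE
      linarith
    congr 1
    linarith
  have hmid := gaussEntropy_mix_le hδ hρ (hone.smul (show 0 < P.R * TTrRot P g by positivity))
    (hrotpos _ hTr) hn hpos3 hb hn hθ hθ'.le h2 h3
  have hrel := gaussEntropy_mix_le hδ hρ (hone.smul (show 0 < P.R * TEq P g by positivity))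
    (hrotpos _ hTe) (by positivity) (posDef_mix hθ hθ'.le
      (hone.smul (show 0 < P.R * TTrRot P g by positivity)) hpos3)
    (mix_pos hθ hθ'.le (hrotpos _ hTr) hb) (mix_pos hθ hθ'.le hn hn) hΓ hΓ'.le h1 hmid
  have hS' := hg.posDef_piTensor hR hT₀ hδ hν hν' hθ hθ' hΓ hΓ'
  have hb' := hg.eRotRel_pos hR hT₀ hδ hθ hθ' hΓ hΓ'
  have hv' : 0 < eVibRel P g := mix_pos hΓ hΓ'.le hVe hvib
  have hE := integrable_and_entropy_eq_gaussEntropy hδ hρ hS' hb'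
    (show 0 < eVibRel P g / (P.R * P.T₀) by positivity) (u g)
  rw [← gaussian_eq_anisotropicGaussian_moments hR hT₀ hδ] at hE
  refine ⟨hE.1, hE.2.trans_le ?_⟩
  convert! hrel using 2
  · rw [piTensor, correctedTensor]
    simp only [smul_smul, smul_add, mul_assoc]
  · rw [eVibRel]
    ring

/-! ### The Gaussian as a minimizer -/

theorem gaussian_pos {P : Params} (hR : 0 < P.R) (hT₀ : 0 < P.T₀) (hδ : 0 < P.δ)
    (hν : -1 / 2 ≤ P.ν) (hν' : P.ν < 1) (hθ : 0 ≤ P.θ) (hθ' : P.θ < 1)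
    (hΓ : 0 ≤ P.Γ) (hΓ' : P.Γ < 1) {g : State → ℝ} (hg : IsDistribution P g)
    (hv : 0 < eVibRel P g) (z : State) : 0 < gaussian P g z := by
  have hb := hg.eRotRel_pos hR hT₀ hδ hθ hθ' hΓ hΓ'
  rw [gaussian_eq_anisotropicGaussian_moments hR hT₀ hδ]
  exact anisotropicGaussian_pos hδ hg.rho_pos (hg.posDef_piTensor hR hT₀ hδ hν hν' hθ hθ' hΓ hΓ')
    (by positivity) (log_one_add_one_div_pos (by positivity)) z

theorem gaussian_minimizes_entropy {P : Params} (hR : 0 < P.R) (hT₀ : 0 < P.T₀) (hδ : 0 < P.δ)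
    (hν : -1 / 2 ≤ P.ν) (hν' : P.ν < 1) (hθ : 0 ≤ P.θ) (hθ' : P.θ < 1)
    (hΓ : 0 ≤ P.Γ) (hΓ' : P.Γ < 1) {g : State → ℝ} (hg : IsDistribution P g)
    (hv : 0 < eVibRel P g) :
    gaussian P g ∈ momentSet P g ∧
      Integrable (fun z => entropyDensity (gaussian P g z)) stateMeasure ∧
      ∀ φ ∈ momentSet P g, extEntropy (gaussian P g) ≤ extEntropy φ ∧
        (extEntropy φ = extEntropy (gaussian P g) → φ =ᵐ[stateMeasure] gaussian P g) := by
  have hS := hg.posDef_piTensor hR hT₀ hδ hν hν' hθ hθ' hΓ hΓ'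
  have hb := hg.eRotRel_pos hR hT₀ hδ hθ hθ' hΓ hΓ'
  have hk : 0 < P.T₀ / TVibRel P g := div_eVibInv_pos hR hT₀ hv
  have hrot := half_mul_TRotRel hR hδ g
  have ha : 0 < P.R * TRotRel P g := by
    rw [← hrot] at hb
    exact pos_of_mul_pos_right hb (by positivity)
  refine ⟨gaussian_mem_momentSet hR hT₀ hδ hg.rho_pos hS ha hv, ?_, fun φ hφ => ?_⟩
  · exact (integrable_and_entropy_anisotropicGaussian (U := u g) hδ hg.rho_pos hS ha hk).1
  · refine extEntropy_anisotropicGaussian_le hδ hg.rho_pos hS ha hk ?_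
    rw [hrot, TVibRel, one_div_exp_div_eVibInv hR hT₀ hv]
    exact hasMoments_of_mem_momentSet hR hT₀ hφ

/-! ### Entropy dissipation -/

theorem hasDerivAt_entropyDensity {s : ℝ} (hs : s ≠ 0) :
    HasDerivAt entropyDensity (Real.log s) s := by
  have := (Real.hasDerivAt_mul_log hs).sub (hasDerivAt_id s)
  rw [add_sub_cancel_right] at this
  exact this

theorem clm_eq_sum_coord (L : ℝ × V →L[ℝ] ℝ) :
    L = L (1, 0) • ContinuousLinearMap.fst ℝ ℝ V +
      ∑ j, L (0, EuclideanSpace.single j 1) •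
        (EuclideanSpace.proj j : V →L[ℝ] ℝ).comp (ContinuousLinearMap.snd ℝ ℝ V) := by
  ext y
  · simp
  · have : y = ∑ j, y j • EuclideanSpace.single j (1 : ℝ) := by
      ext i
      simp [Finset.sum_apply, Pi.single_apply]
    have h2 : ((0 : ℝ), y) = ∑ j, y j • ((0 : ℝ), (EuclideanSpace.single j (1 : ℝ) : V)) := by
      conv_lhs => rw [this]
      simp [Prod.ext_iff, Prod.fst_sum, Prod.snd_sum]
    simp only [ContinuousLinearMap.comp_apply, ContinuousLinearMap.inr_apply]
    conv_lhs => rw [h2, map_sum]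
    simp only [map_smul]
    simp [mul_comm]

/-- The derivative with respect to a parameter is a measurable function of the other variable, as a
limit of difference quotients. -/
theorem aestronglyMeasurable_fderiv {U : Set (ℝ × V)} (hU : IsOpen U) {f : ℝ × V → State → ℝ}
    (hm : ∀ y ∈ U, AEStronglyMeasurable (f y) stateMeasure) {y : ℝ × V} (hy : y ∈ U)
    (hd : ∀ᵐ z ∂stateMeasure, DifferentiableAt ℝ (fun y' => f y' z) y) :
    AEStronglyMeasurable (fun z => fderiv ℝ (fun y' => f y' z) y) stateMeasure := by
  have key : ∀ e : ℝ × V,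
      AEStronglyMeasurable (fun z => fderiv ℝ (fun y' => f y' z) y e) stateMeasure := fun e => by
    have h1 : Filter.Tendsto (fun n : ℕ => 1 / ((n : ℝ) + 1)) Filter.atTop (nhds 0) :=
      tendsto_one_div_add_atTop_nhds_zero_nat
    have h2 : Filter.Tendsto (fun n : ℕ => y + (1 / ((n : ℝ) + 1)) • e) Filter.atTop (nhds y) := by
      simpa using (h1.smul_const e).const_add y
    -- the sequence is shifted by `n₀` to stay in `U`, where `f` is measurable
    obtain ⟨n₀, hn₀⟩ := Filter.eventually_atTop.1 (h2.eventually (hU.mem_nhds hy))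
    have h3 : Filter.Tendsto (fun n : ℕ => 1 / (((n + n₀ : ℕ) : ℝ) + 1)) Filter.atTop
        (nhdsWithin 0 {0}ᶜ) := by
      refine tendsto_nhdsWithin_iff.2 ⟨h1.comp (Filter.tendsto_add_atTop_nat n₀),
        Filter.Eventually.of_forall fun n => ?_⟩
      exact (Nat.one_div_pos_of_nat (n := n + n₀)).ne'
    refine aestronglyMeasurable_of_tendsto_ae (u := Filter.atTop)
      (f := fun (n : ℕ) z => (1 / (((n + n₀ : ℕ) : ℝ) + 1))⁻¹ •
        (f (y + (1 / (((n + n₀ : ℕ) : ℝ) + 1)) • e) z - f y z)) (fun n => ?_) ?_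
    · exact ((hm _ (hn₀ _ (Nat.le_add_left _ _))).sub (hm y hy)).const_smul
        (1 / (((n + n₀ : ℕ) : ℝ) + 1))⁻¹
    · filter_upwards [hd] with z hz
      exact (hz.hasFDerivAt.hasLineDerivAt e).tendsto_slope_zero.comp h3
  have h : (fun z => fderiv ℝ (fun y' => f y' z) y) = fun z =>
      fderiv ℝ (fun y' => f y' z) y (1, 0) • ContinuousLinearMap.fst ℝ ℝ V +
      ∑ j, fderiv ℝ (fun y' => f y' z) y (0, EuclideanSpace.single j 1) •
        (EuclideanSpace.proj j : V →L[ℝ] ℝ).comp (ContinuousLinearMap.snd ℝ ℝ V) :=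
    funext fun z => clm_eq_sum_coord _
  rw [h]
  exact ((key _).smul_const _).add
    (Finset.aestronglyMeasurable_fun_sum _ fun j _ => (key _).smul_const _)

section Solution

variable {P : Params} {U : Set (ℝ × V)} {τ : ℝ × V → ℝ} {f : ℝ × V → State → ℝ}

/-- A classical solution is positive: at a zero, which is a minimum, the left-hand side of the
equation vanishes, while the right-hand side is `𝓖[f] / τ > 0`. -/
theorem IsClassicalSolution.ae_pos (hf : IsClassicalSolution P τ U f) (hU : IsOpen U)
    (hτ : ∀ y ∈ U, 0 < τ y) (hG : ∀ y ∈ U, ∀ z, 0 < gaussian P (f y) z) :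
    ∀ᵐ z ∂stateMeasure, ∀ y ∈ U, 0 < f y z := by
  filter_upwards [hf.nonneg, hf.equation] with z h0 heq y hy
  refine lt_of_le_of_ne (h0 y hy) fun hz => ?_
  have hmin : IsLocalMin (fun y' => f y' z) y := by
    filter_upwards [hU.mem_nhds hy] with y' hy'
    rw [← hz]
    exact h0 y' hy'
  have h := heq y hy
  simp only [dt, dx, hmin.fderiv_eq_zero] at h
  have h1 := hG y hy z
  have h2 := hτ y hy
  rw [← hz] at h
  have h3 : 0 < 1 / τ y * (gaussian P (f y) z - 0) := by
    rw [sub_zero]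
    positivity
  rw [← h] at h3
  simp at h3

variable (hf : IsClassicalSolution P τ U f)
include hf

theorem IsClassicalSolution.integrable_mul_entropyDensity {w : State → ℝ} (hw : Measurable w)
    (hw' : ∀ z, |w z| ≤ 1 + ‖z.1‖) {y : ℝ × V} (hy : y ∈ U) :
    Integrable (fun z => w z * entropyDensity (f y z)) stateMeasure := by
  refine (hf.integrable_entropy y hy).mono (hw.aestronglyMeasurable.mul
    (measurable_entropyDensity.comp_aemeasurable
      (hf.isDistribution y hy).finiteMoments.meas.aemeasurable).aestronglyMeasurable) ?_
  refine Filter.Eventually.of_forall fun z => ?_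
  rw [norm_mul, norm_mul, Real.norm_eq_abs, Real.norm_eq_abs, Real.norm_eq_abs, Real.norm_eq_abs,
    abs_abs]
  exact mul_le_mul_of_nonneg_right ((hw' z).trans (le_abs_self _)) (abs_nonneg _)

/-- Differentiation under the integral sign of the moments of the entropy density. -/
theorem IsClassicalSolution.hasFDerivAt_integral (hU : IsOpen U)
    (hpos : ∀ᵐ z ∂stateMeasure, ∀ y ∈ U, 0 < f y z) {w : State → ℝ} (hw : Measurable w)
    (hw' : ∀ z, |w z| ≤ 1 + ‖z.1‖) {y : ℝ × V} (hy : y ∈ U) :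
    Integrable (fun z => (w z * Real.log (f y z)) • fderiv ℝ (fun y' => f y' z) y) stateMeasure ∧
      HasFDerivAt (fun y' => ∫ z, w z * entropyDensity (f y' z) ∂stateMeasure)
        (∫ z, (w z * Real.log (f y z)) • fderiv ℝ (fun y' => f y' z) y ∂stateMeasure) y := by
  have hm : ∀ y ∈ U, AEStronglyMeasurable (f y) stateMeasure := fun y hy =>
    (hf.isDistribution y hy).finiteMoments.meas
  obtain ⟨N, hN, b, hb, hbound⟩ := hf.dominated y hy
  have hF' : AEStronglyMeasurable
      (fun z => (w z * Real.log (f y z)) • fderiv ℝ (fun y' => f y' z) y) stateMeasure :=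
    (hw.aestronglyMeasurable.mul (Real.measurable_log.comp_aemeasurable
      (hm y hy).aemeasurable).aestronglyMeasurable).smul
      (aestronglyMeasurable_fderiv hU hm hy (hf.differentiable.mono fun z hz => hz y hy))
  have hle : ∀ᵐ z ∂stateMeasure, ∀ y' ∈ N ∩ U,
      ‖(w z * Real.log (f y' z)) • fderiv ℝ (fun y' => f y' z) y'‖ ≤ b z := by
    filter_upwards [hbound] with z hz y' hy'
    refine le_trans ?_ (hz y' hy'.1)
    rw [norm_smul, norm_mul, Real.norm_eq_abs, Real.norm_eq_abs]
    gcongr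
    exact hw' z
  refine ⟨hb.mono' hF' (hle.mono fun z hz => hz y ⟨mem_of_mem_nhds hN, hy⟩), ?_⟩
  refine hasFDerivAt_integral_of_dominated_of_fderiv_le
    (F' := fun y' z => (w z * Real.log (f y' z)) • fderiv ℝ (fun y' => f y' z) y') (bound := b)
    (Filter.inter_mem hN (hU.mem_nhds hy)) ?_ (hf.integrable_mul_entropyDensity hw hw' hy) hF' hle
    hb ?_
  · filter_upwards [hU.mem_nhds hy] with y' hy'
    exact (hf.integrable_mul_entropyDensity hw hw' hy').aestronglyMeasurable
  · filter_upwards [hpos, hf.differentiable] with z hz hd y' hy'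
    have := ((hasDerivAt_entropyDensity (hz y' hy'.2).ne').comp_hasFDerivAt y'
      (hd y' hy'.2).hasFDerivAt).const_mul (w z)
    rwa [smul_smul] at this

/-- The entropy balance. -/
theorem IsClassicalSolution.entropy_balance (hU : IsOpen U)
    (hpos : ∀ᵐ z ∂stateMeasure, ∀ y ∈ U, 0 < f y z) {y : ℝ × V} (hy : y ∈ U) :
    DifferentiableAt ℝ (fun y' => entropy (f y')) y ∧
      (∀ j, DifferentiableAt ℝ (fun y' => entropyFlux (f y') j) y) ∧
      Integrable (fun z => 1 / τ y * (gaussian P (f y) z - f y z) * Real.log (f y z))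
        stateMeasure ∧
      dt (fun y' => entropy (f y')) y + ∑ j, dx j (fun y' => entropyFlux (f y') j) y =
        ∫ z, 1 / τ y * (gaussian P (f y) z - f y z) * Real.log (f y z) ∂stateMeasure := by
  obtain ⟨i0, d0⟩ := hf.hasFDerivAt_integral hU hpos (w := fun _ => 1) measurable_const
    (fun z => by simp) hy
  have hj := fun j : Fin 3 => hf.hasFDerivAt_integral hU hpos (w := fun z => z.1 j) (by fun_prop)
    (fun z => (abs_coord_le_norm z.1 j).trans (by simp)) hy
  simp only [one_mul] at i0 d0
  have d0' : HasFDerivAt (fun y' => entropy (f y')) _ y := d0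
  have dj' : ∀ j, HasFDerivAt (fun y' => entropyFlux (f y') j) _ y := fun j => (hj j).2
  have a0 := i0.apply_continuousLinearMap ((1, 0) : ℝ × V)
  have aj := fun j => (hj j).1.apply_continuousLinearMap
    ((0, EuclideanSpace.single j 1) : ℝ × V)
  have hsum := a0.add (integrable_finsetSum Finset.univ fun j _ => aj j)
  have heq : (fun z => ((Real.log (f y z)) • fderiv ℝ (fun y' => f y' z) y) (1, 0) +
      ∑ j, ((z.1 j * Real.log (f y z)) • fderiv ℝ (fun y' => f y' z) y)
        (0, EuclideanSpace.single j 1)) =ᵐ[stateMeasure]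
      fun z => 1 / τ y * (gaussian P (f y) z - f y z) * Real.log (f y z) := by
    filter_upwards [hf.equation] with z hz
    rw [← hz y hy]
    simp only [dt, dx, _root_.smul_apply, smul_eq_mul, add_mul, Finset.sum_mul]
    rw [mul_comm (Real.log _)]
    congr 1
    exact Finset.sum_congr rfl fun j _ => by ring
  refine ⟨d0'.differentiableAt, fun j => (dj' j).differentiableAt, hsum.congr heq, ?_⟩
  rw [← integral_congr_ae heq, integral_add a0 (integrable_finsetSum _ fun j _ => aj j),
    integral_finsetSum _ fun j _ => aj j, dt, d0'.fderiv, ContinuousLinearMap.integral_apply i0]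
  congr 1
  refine Finset.sum_congr rfl fun j _ => ?_
  rw [dx, (dj' j).fderiv, ContinuousLinearMap.integral_apply (hj j).1]

end Solution

/-- By convexity the dissipation `⟨(𝓖[g] - g) log g⟩` is at most `ℍ(𝓖[g]) - ℍ(g)`. -/
theorem integral_dissipation_nonpos {g G : State → ℝ} {c : ℝ} (hc : 0 ≤ c)
    (hg : ∀ᵐ z ∂stateMeasure, 0 < g z) (hG : ∀ z, 0 < G z)
    (hge : Integrable (fun z => entropyDensity (g z)) stateMeasure)
    (hGe : Integrable (fun z => entropyDensity (G z)) stateMeasure)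
    (hle : entropy G ≤ entropy g)
    (hi : Integrable (fun z => c * (G z - g z) * Real.log (g z)) stateMeasure) :
    ∫ z, c * (G z - g z) * Real.log (g z) ∂stateMeasure ≤ 0 := by
  have h1 := integral_mono_ae hi ((hGe.sub hge).const_mul c) (by
    filter_upwards [hg] with z hz
    have h := mul_log_sub_le_entropyDensity (hG z).le hz
    rw [mul_assoc, Pi.sub_apply]
    refine mul_le_mul_of_nonneg_left ?_ hc
    have h2 : entropyDensity (g z) = g z * Real.log (g z) - g z := rfl
    rw [h2]
    linarith)
  refine h1.trans ?_
  rw [integral_const_mul]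
  refine mul_nonpos_of_nonneg_of_nonpos hc ?_
  have := integral_sub hGe hge
  simp only [Pi.sub_apply]
  rw [this]
  exact sub_nonpos.2 hle

/-! ### Equilibrium -/

/-- If `g` and `𝓖[g]` have the same energies and `Γ > 0`, all the temperatures coincide. -/
theorem temperatures_eq {P : Params} (hR : 0 < P.R) (hδ : 0 < P.δ) (hθ : 0 ≤ P.θ)
    (hΓ : 0 < P.Γ) (hΓ' : P.Γ < 1) {g : State → ℝ} (hg : IsDistribution P g)
    (hstress : stress g = piTensor P g) (hrot : ERot P g = eRotRel P g) :
    TTrRot P g = TEq P g ∧ TTr P g = TEq P g ∧ TRotRel P g = TEq P g := by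
  have htr := hg.trace_stress_eq_TTr hR
  have htr' : (piTensor P g).trace = 3 * (P.Γ * P.R * TEq P g + (1 - P.Γ) *
      (P.θ * P.R * TTrRot P g)) + (1 - P.Γ) * (1 - P.θ) * (P.ν * (stress g).trace +
        3 * ((1 - P.ν) * P.R * TTr P g)) := by
    simp only [piTensor, correctedTensor, trace_add, trace_smul, trace_one, smul_eq_mul,
      Fintype.card_fin]
    push_cast
    ring
  rw [← hstress, htr] at htr'
  have h1 : P.R * TTr P g = P.R * (P.Γ * TEq P g + (1 - P.Γ) * (P.θ * TTrRot P g +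
      (1 - P.θ) * TTr P g)) := by linarith
  have hER : ERot P g = P.δ / 2 * P.R * TRotRel P g := by
    rw [hrot, ← half_mul_TRotRel hR hδ g]
    ring
  have h2 : P.δ / 2 * P.R * TRotRel P g = P.δ / 2 * P.R * (P.Γ * TEq P g +
      (1 - P.Γ) * (P.θ * TTrRot P g + (1 - P.θ) * TRotRel P g)) := by
    have := hrot
    rw [eRotRel, hER, eRot, eRot] at this
    linarith
  have h3 : (3 + P.δ) * P.R * TTrRot P g =
      (3 + P.δ) * P.R * (3 / (3 + P.δ) * TTr P g + P.δ / (3 + P.δ) * TRotRel P g) := by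
    have hT : 3 * P.R * TTr P g = 2 * ETr g := by rw [← htr, hg.trace_stress]
    have : (3 + P.δ) * P.R * TTrRot P g = 2 * (ETr g + ERot P g) := by
      rw [TTrRot, eTrRotInv]
      field_simp
    rw [this, hER]
    field_simp
    linarith
  replace h1 := mul_left_cancel₀ hR.ne' h1
  replace h2 := mul_left_cancel₀ (by positivity) h2
  replace h3 := mul_left_cancel₀ (by positivity) h3
  have e1 : (P.Γ + (1 - P.Γ) * P.θ) * (TTr P g - TRotRel P g) = 0 := by linarith
  have h4 : 0 ≤ (1 - P.Γ) * P.θ := mul_nonneg (by linarith) hθ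
  have e2 : TTr P g = TRotRel P g :=
    sub_eq_zero.1 ((mul_eq_zero.1 e1).resolve_left (by linarith))
  have e3 : TTrRot P g = TRotRel P g := by
    rw [h3, e2]
    field_simp
  have e4 : P.Γ * (TRotRel P g - TEq P g) = 0 := by
    rw [e3] at h2
    linarith
  have e5 : TRotRel P g = TEq P g := sub_eq_zero.1 ((mul_eq_zero.1 e4).resolve_left hΓ.ne')
  exact ⟨e3.trans e5, e2.trans e5, e5⟩

/-- Once the temperatures coincide, `Θ = Π` forces the stress tensor to be isotropic, because
`(1 - Γ) (1 - θ) ν < 1`. -/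
theorem piTensor_eq_of_temperatures_eq {P : Params} (hν' : P.ν < 1) (hθ : 0 ≤ P.θ)
    (hθ' : P.θ < 1) (hΓ : 0 < P.Γ) (hΓ' : P.Γ < 1) {g : State → ℝ}
    (hstress : stress g = piTensor P g) (h1 : TTrRot P g = TEq P g) (h2 : TTr P g = TEq P g) :
    piTensor P g = (P.R * TEq P g) • (1 : Matrix (Fin 3) (Fin 3) ℝ) := by
  ext j k
  have h := congrFun (congrFun hstress j) k
  have hpi : piTensor P g j k = P.Γ * P.R * TEq P g * (1 : Matrix (Fin 3) (Fin 3) ℝ) j k +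
      (1 - P.Γ) * (P.θ * P.R * TEq P g * (1 : Matrix (Fin 3) (Fin 3) ℝ) j k + (1 - P.θ) *
        (P.ν * stress g j k + (1 - P.ν) * P.R * TEq P g * (1 : Matrix (Fin 3) (Fin 3) ℝ) j k)) := by
    simp only [piTensor, correctedTensor, h1, h2, Matrix.add_apply, Matrix.smul_apply, smul_eq_mul]
  have hc : 0 < 1 - (1 - P.Γ) * (1 - P.θ) * P.ν := by
    have hc0 : 0 < (1 - P.Γ) * (1 - P.θ) := mul_pos (by linarith) (by linarith)
    have hc1 : (1 - P.Γ) * (1 - P.θ) < 1 := by nlinarith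
    nlinarith
  have hz : (1 - (1 - P.Γ) * (1 - P.θ) * P.ν) *
      (stress g j k - P.R * TEq P g * (1 : Matrix (Fin 3) (Fin 3) ℝ) j k) = 0 := by
    rw [← h] at hpi
    linarith
  rw [← h, Matrix.smul_apply, smul_eq_mul]
  exact sub_eq_zero.1 ((mul_eq_zero.1 hz).resolve_left hc.ne')

theorem gaussian_eq_maxwellian {P : Params} (hR : 0 < P.R) {g : State → ℝ} (hT : 0 < TEq P g)
    (hpi : piTensor P g = (P.R * TEq P g) • (1 : Matrix (Fin 3) (Fin 3) ℝ))
    (hrot : TRotRel P g = TEq P g) (hvib : TVibRel P g = TEq P g) :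
    gaussian P g = maxwellian P g := by
  have hx : 0 < 2 * Real.pi * P.R * TEq P g := by positivity
  have hτ : 0 < P.R * TEq P g := by positivity
  have hdet : Real.sqrt ((2 * Real.pi) • (P.R * TEq P g) • (1 : Matrix (Fin 3) (Fin 3) ℝ)).det =
      (2 * Real.pi * P.R * TEq P g) ^ (3 / 2 : ℝ) := by
    rw [smul_smul, det_smul, det_one, mul_one, Fintype.card_fin, Real.sqrt_eq_rpow,
      ← Real.rpow_natCast, ← Real.rpow_mul (by positivity)]
    norm_num [mul_assoc]
  have hinv : ((P.R * TEq P g) • (1 : Matrix (Fin 3) (Fin 3) ℝ))⁻¹ =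
      (P.R * TEq P g)⁻¹ • (1 : Matrix (Fin 3) (Fin 3) ℝ) := by
    refine Matrix.inv_eq_left_inv ?_
    rw [smul_mul_smul_comm, Matrix.one_mul, inv_mul_cancel₀ hτ.ne', one_smul]
  ext z
  rw [gaussian, maxwellian, hpi, hrot, hvib, hdet, hinv]
  congr 3
  simp only [smul_mulVec, one_mulVec, dotProduct_smul, smul_eq_mul]
  congr 1
  have : (fun j => z.1 j - u g j) ⬝ᵥ (fun j => z.1 j - u g j) = ∑ j, (z.1 j - u g j) ^ 2 := by
    simp [dotProduct, sq]
  rw [this]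
  field_simp

theorem ae_eq_maxwellian {P : Params} (hR : 0 < P.R) (hT₀ : 0 < P.T₀) (hδ : 0 < P.δ)
    (hν : -1 / 2 ≤ P.ν) (hν' : P.ν < 1) (hθ : 0 ≤ P.θ) (hθ' : P.θ < 1)
    (hΓ : 0 < P.Γ) (hΓ' : P.Γ < 1) {g : State → ℝ} (hg : IsDistribution P g)
    (h : g =ᵐ[stateMeasure] gaussian P g) : g =ᵐ[stateMeasure] maxwellian P g := by
  obtain ⟨hT, -⟩ := hg.TEq_spec hR hT₀ hδ
  have hv : 0 < eVibRel P g := add_pos_of_pos_of_nonneg (mul_pos hΓ (eVib_pos hR hT₀ hT))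
    (mul_nonneg (by linarith) (hg.EVib_nonneg hR hT₀))
  have hm := hg.hasMoments hR hT₀
  have hG := hasMoments_of_mem_momentSet hR hT₀
    (gaussian_minimizes_entropy hR hT₀ hδ hν hν' hθ hθ' hΓ.le hΓ' hg hv).1
  have hint : ∀ m : State → ℝ, ∫ z, m z * g z ∂stateMeasure =
      ∫ z, m z * gaussian P g z ∂stateMeasure := fun m =>
    integral_congr_ae (h.mono fun z hz => by simp only [hz])
  have hρ := hg.rho_pos.ne'
  have hstress : stress g = piTensor P g := by
    ext j k
    refine mul_left_cancel₀ hρ ?_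
    rw [← hm.second, ← hG.second]
    exact hint _
  have hrot : ERot P g = eRotRel P g := by
    refine mul_left_cancel₀ hρ ?_
    rw [← hm.rotational, ← hG.rotational]
    exact hint _
  have hvib : EVib P g = eVibRel P g := by
    have h1 := hm.vibrational.symm.trans ((hint _).trans hG.vibrational)
    have h2 := mul_left_cancel₀ hρ h1
    have h3 : P.R * P.T₀ ≠ 0 := by positivity
    field_simp at h2
    exact h2
  obtain ⟨t1, t2, t3⟩ := temperatures_eq hR hδ hθ hΓ hΓ' hg hstress hrot
  have hvib' : eVibRel P g = eVib P (TEq P g) := by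
    have h1 := hvib
    rw [eVibRel] at h1
    have h2 : P.Γ * (EVib P g - eVib P (TEq P g)) = 0 := by linarith
    rw [← hvib]
    exact sub_eq_zero.1 ((mul_eq_zero.1 h2).resolve_left hΓ.ne')
  have t4 : TVibRel P g = TEq P g := by rw [TVibRel, hvib', eVibInv_eVib hR hT₀ hT]
  rwa [gaussian_eq_maxwellian hR hT
    (piTensor_eq_of_temperatures_eq hν' hθ hθ' hΓ hΓ' hstress t1 t2) t3 t4] at h

end ESBGK

theorem proposition3 (P : ESBGK.Params) (hR : 0 < P.R) (hT₀ : 0 < P.T₀) (hδ : 0 < P.δ)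
    (hν : -1 / 2 ≤ P.ν) (hν' : P.ν < 1) (hθ : 0 ≤ P.θ) (hθ' : P.θ < 1)
    (hΓ : 0 ≤ P.Γ) (hΓ' : P.Γ < 1) :
    -- positivity of the corrected tensor
    (∀ (Θ : Matrix (Fin 3) (Fin 3) ℝ) (Ttr Ttrrot Teq : ℝ),
      Θ.PosDef → 0 < Ttr → Θ.trace = 3 * P.R * Ttr → 0 < Ttrrot → 0 < Teq →
      (ESBGK.correctedTensor P Θ Ttr Ttrrot Teq).IsSymm ∧
        (ESBGK.correctedTensor P Θ Ttr Ttrrot Teq).PosDef) ∧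
    -- entropy minimization
    (∀ g : ESBGK.State → ℝ, ESBGK.IsDistribution P g → 0 < ESBGK.eVibRel P g →
      ESBGK.gaussian P g ∈ ESBGK.momentSet P g ∧
      MeasureTheory.Integrable (fun z => ESBGK.entropyDensity (ESBGK.gaussian P g z))
        ESBGK.stateMeasure ∧
      ∀ φ ∈ ESBGK.momentSet P g,
        ESBGK.extEntropy (ESBGK.gaussian P g) ≤ ESBGK.extEntropy φ ∧
        (ESBGK.extEntropy φ = ESBGK.extEntropy (ESBGK.gaussian P g) →
          φ =ᵐ[ESBGK.stateMeasure] ESBGK.gaussian P g)) ∧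
    -- entropy dissipation
    (∀ (U : Set (ℝ × ESBGK.V)) (τ : ℝ × ESBGK.V → ℝ) (g : ℝ × ESBGK.V → ESBGK.State → ℝ),
      IsOpen U → (∀ y ∈ U, 0 < τ y) → ESBGK.IsClassicalSolution P τ U g →
      ∀ y ∈ U,
        DifferentiableAt ℝ (fun y' => ESBGK.entropy (g y')) y ∧
        (∀ j, DifferentiableAt ℝ (fun y' => ESBGK.entropyFlux (g y') j) y) ∧
        MeasureTheory.Integrable
          (fun z => 1 / τ y * (ESBGK.gaussian P (g y) z - g y z) * Real.log (g y z))
          ESBGK.stateMeasure ∧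
        ESBGK.dt (fun y' => ESBGK.entropy (g y')) y
            + ∑ j, ESBGK.dx j (fun y' => ESBGK.entropyFlux (g y') j) y
          = ∫ z, 1 / τ y * (ESBGK.gaussian P (g y) z - g y z) * Real.log (g y z)
              ∂ESBGK.stateMeasure ∧
        ∫ z, 1 / τ y * (ESBGK.gaussian P (g y) z - g y z) * Real.log (g y z)
            ∂ESBGK.stateMeasure ≤ 0) ∧
    -- equilibrium
    (0 < P.Γ → ∀ g : ESBGK.State → ℝ, ESBGK.IsDistribution P g →
      g =ᵐ[ESBGK.stateMeasure] ESBGK.gaussian P g →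
      g =ᵐ[ESBGK.stateMeasure] ESBGK.maxwellian P g) := by
  refine ⟨fun Θ Ttr Ttrrot Teq hΘ _ htr hTtrrot hTeq => ?_, fun g hg hv => ?_,
    fun U τ g hU hτ hsol y hy => ?_, fun hΓ0 g hg h => ?_⟩
  · have h := ESBGK.posDef_correctedTensor P hR hν hν' hθ hθ' hΓ hΓ' hΘ htr hTtrrot hTeq
    refine ⟨?_, h⟩
    have hH := h.isHermitian
    rwa [Matrix.IsHermitian, Matrix.conjTranspose_eq_transpose_of_trivial] at hH
  · exact ESBGK.gaussian_minimizes_entropy hR hT₀ hδ hν hν' hθ hθ' hΓ hΓ' hg hv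
  · have hG : ∀ y ∈ U, ∀ z, 0 < ESBGK.gaussian P (g y) z := fun y hy =>
      ESBGK.gaussian_pos hR hT₀ hδ hν hν' hθ hθ' hΓ hΓ' (hsol.isDistribution y hy)
        (hsol.eVibRel_pos y hy)
    have hpos := hsol.ae_pos hU hτ hG
    obtain ⟨h1, h2, h3, h4⟩ := hsol.entropy_balance hU hpos hy
    refine ⟨h1, h2, h3, h4, ?_⟩
    have hpos' := hpos.mono fun z hz => hz y hy
    have hd := hsol.isDistribution y hy
    have hent := hsol.integrable_mul_entropyDensity (w := fun _ => 1) measurable_const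
      (fun z => by simp) hy
    simp only [one_mul] at hent
    obtain ⟨h5, h6⟩ := ESBGK.entropy_gaussian_le hR hT₀ hδ hν hν' hθ hθ' hΓ hΓ' hd
      (hd.EVib_pos hR hT₀ hpos') hent
    exact ESBGK.integral_dissipation_nonpos (one_div_pos.2 (hτ y hy)).le hpos' (hG y hy) hent h5 h6
      h3
  · exact ESBGK.ae_eq_maxwellian hR hT₀ hδ hν hν' hθ hθ' hΓ0 hΓ' hg h
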